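/- Let $\mathbf{Mfld}$ be the category of smooth manifolds (finite dimensional, Hausdorff, second countable, without boundary) and smooth maps. For $k\ge 0$ let $\Omega^k:\mathbf{Mfld}^{op}\to\mathbf{Set}$ be the sheaf of differential $k$-forms and $\int\Omega^k\to\mathbf{Mfld}$ its category of elements. A $k$-form on a stack $\mathcal X$ over $\mathbf{Mfld}$ is a map $\mathcal X\to\int\Omega^k$ over $\mathbf{Mfld}$; write $\Omega^k(\mathcal X)$ for the set of these. By the Yoneda lemma $\Omega^k(y(M))=\Omega^k(M)$ for every manifold $M$, where $y$ is the Yoneda embedding of manifolds into stacks. Let $G=(G_1\rightrightarrows G_0)$ be a Lie groupoid with source $s$ and target $t$, and let $BG$ be the stack of principal $G$-bundles. An atlas of $BG$ is a map $\theta:y(X)\to BG$ such that for every map $y(M)\to BG$ the fibre product of $y(M)$ and $y(X)$ over $BG$ is representable by a manifold whose projection to $M$ is a surjective submersion. Then: (1) There is a map $\theta:y(G_0)\to BG$ that sends $\mathrm{id}_{G_0}$ to (a bundle isomorphic to) the unit bundle $t:G_1\to G_0$. Every such map is an atlas, and $G_1$ with the projections $s$ and $t$ represents the fibre product of $y(G_0)$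 with itself over $BG$ along it. (2) For every atlas $\theta:y(G_0)\to BG$ along which $G_1$, with the projections $s$ and $t$, represents the fibre product of $y(G_0)$ with itself over $BG$, the map $\alpha\mapsto\alpha\circ\theta$ is a bijection from $\Omega^k(BG)$ onto the set of basic $k$-forms on $G_0$, that is, of those $\mu\in\Omega^k(G_0)$ with $s^*\mu=t^*\mu$. -/

import Mathlib

open CategoryTheory Opposite Manifold Set
open scoped ContDiff

universe u

/-! ### The category of smooth manifolds -/

/-- A smooth manifold: finite dimensional, without boundary, Hausdorff and second countable. -/
structure Mfld : Type (u + 1) where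
  carrier : Type u
  dim : ℕ
  [topology : TopologicalSpace carrier]
  [charted : ChartedSpace (EuclideanSpace ℝ (Fin dim)) carrier]
  [smooth : IsManifold (𝓡 dim) ∞ carrier]
  [hausdorff : T2Space carrier]
  [secondCountable : SecondCountableTopology carrier]

namespace Mfld

instance : CoeSort Mfld.{u} (Type u) := ⟨Mfld.carrier⟩

attribute [instance] topology charted smooth hausdorff secondCountable

/-- The model with corners on which the manifold is modelled. -/
noncomputable abbrev model (M : Mfld.{u}) : ModelWithCorners ℝ (EuclideanSpace ℝ (Fin M.dim))
    (EuclideanSpace ℝ (Fin M.dim)) := 𝓡 M.dim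

noncomputable instance : Category.{u} Mfld.{u} where
  Hom M N := C^∞⟮M.model, M; N.model, N⟯
  id _ := ContMDiffMap.id
  comp f g := ContMDiffMap.comp g f

noncomputable instance : ConcreteCategory Mfld.{u} (fun M N => C^∞⟮M.model, M; N.model, N⟯) where
  hom f := f
  ofHom f := f

theorem contMDiff {M N : Mfld.{u}} (f : M ⟶ N) : ContMDiff M.model N.model ∞ (f : M → N) :=
  ContMDiffMap.contMDiff (ConcreteCategory.hom f)

end Mfld

/-! ### Differential forms on manifolds -/

/-- The expression of a field of alternating forms in the chart `e`. -/
noncomputable def chartExpr {M : Mfld.{u}} {k : ℕ}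
    (η : ∀ x : M, TangentSpace M.model x [⋀^Fin k]→L[ℝ] ℝ)
    (e : OpenPartialHomeomorph M (EuclideanSpace ℝ (Fin M.dim)))
    (v : EuclideanSpace ℝ (Fin M.dim)) :
    EuclideanSpace ℝ (Fin M.dim) [⋀^Fin k]→L[ℝ] ℝ :=
  (η (e.symm v)).compContinuousLinearMap (mfderiv M.model M.model e.symm v)

/-- A differential `k`-form on `M`: a field of alternating `k`-linear forms on the tangent spaces
whose expression in every chart of the atlas is smooth. -/
@[ext]
structure DiffForm (M : Mfld.{u}) (k : ℕ) : Type u where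
  toFun : ∀ x : M, TangentSpace M.model x [⋀^Fin k]→L[ℝ] ℝ
  contDiffOn : ∀ e ∈ atlas (EuclideanSpace ℝ (Fin M.dim)) M,
    ContDiffOn ℝ ∞ (chartExpr toFun e) e.target

theorem contDiff_compContinuousLinearMap {m n k : ℕ} :
    ContDiff ℝ ∞ (fun p : (EuclideanSpace ℝ (Fin n) [⋀^Fin k]→L[ℝ] ℝ) ×
      (EuclideanSpace ℝ (Fin m) →L[ℝ] EuclideanSpace ℝ (Fin n)) =>
        p.1.compContinuousLinearMap p.2) := by
  let T : (EuclideanSpace ℝ (Fin m) [⋀^Fin k]→L[ℝ] ℝ) →L[ℝ]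
      ContinuousMultilinearMap ℝ (fun _ : Fin k => EuclideanSpace ℝ (Fin m)) ℝ :=
    ContinuousAlternatingMap.toContinuousMultilinearMapCLM ℝ
  have hinj : Function.Injective T :=
    ContinuousAlternatingMap.toContinuousMultilinearMap_injective
  have : FiniteDimensional ℝ
      (ContinuousMultilinearMap ℝ (fun _ : Fin k => EuclideanSpace ℝ (Fin m)) ℝ) :=
    Module.Finite.of_injective
      (ContinuousMultilinearMap.toMultilinearMapLinear (R' := ℝ) (A := ℝ)
        (M₁ := fun _ : Fin k => EuclideanSpace ℝ (Fin m)) (M₂ := ℝ))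
      ContinuousMultilinearMap.toMultilinearMap_injective
  obtain ⟨L, hL⟩ := LinearMap.exists_leftInverse_of_injective T.toLinearMap
    (LinearMap.ker_eq_bot.2 hinj)
  have h1 : ContDiff ℝ ∞ (fun p : (EuclideanSpace ℝ (Fin n) [⋀^Fin k]→L[ℝ] ℝ) ×
      (EuclideanSpace ℝ (Fin m) →L[ℝ] EuclideanSpace ℝ (Fin n)) =>
        (ContinuousMultilinearMap.compContinuousLinearMapContinuousMultilinear ℝ
          (fun _ : Fin k => EuclideanSpace ℝ (Fin m))
          (fun _ : Fin k => EuclideanSpace ℝ (Fin n)) ℝ (fun _ => p.2))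
          (ContinuousAlternatingMap.toContinuousMultilinearMapCLM ℝ p.1)) := by
    refine ContDiff.clm_apply ?_ ?_
    · exact (ContinuousMultilinearMap.contDiff _).comp (contDiff_pi.2 fun _ => contDiff_snd)
    · exact (ContinuousLinearMap.contDiff _).comp contDiff_fst
  have h2 := (LinearMap.toContinuousLinearMap L).contDiff (n := ∞) |>.comp h1
  convert h2 using 1
  funext p
  exact (LinearMap.congr_fun hL (p.1.compContinuousLinearMap p.2)).symm

namespace DiffForm

variable {M N L : Mfld.{u}} {k : ℕ}

/-- The pointwise pullback of a field of alternating forms along a smooth map. -/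
noncomputable def pullbackFun (f : M ⟶ N)
    (η : ∀ x : N, TangentSpace N.model x [⋀^Fin k]→L[ℝ] ℝ) (x : M) :
    TangentSpace M.model x [⋀^Fin k]→L[ℝ] ℝ :=
  (η (f x)).compContinuousLinearMap (mfderiv M.model N.model (f : M → N) x)

theorem chartExpr_pullbackFun_eq (f : M ⟶ N)
    (η : ∀ x : N, TangentSpace N.model x [⋀^Fin k]→L[ℝ] ℝ)
    {e : OpenPartialHomeomorph M (EuclideanSpace ℝ (Fin M.dim))}
    (he : e ∈ atlas (EuclideanSpace ℝ (Fin M.dim)) M)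
    {e' : OpenPartialHomeomorph N (EuclideanSpace ℝ (Fin N.dim))}
    (he' : e' ∈ atlas (EuclideanSpace ℝ (Fin N.dim)) N)
    {v : EuclideanSpace ℝ (Fin M.dim)} (hv : v ∈ e.target) (hfv : f (e.symm v) ∈ e'.source) :
    chartExpr (pullbackFun f η) e v =
      (chartExpr η e' (e' (f (e.symm v)))).compContinuousLinearMap
        (fderiv ℝ (fun w => e' (f (e.symm w))) v) := by
  have h1 : (1 : ℕ∞ω) ≤ ∞ := by exact_mod_cast le_top
  have : IsManifold M.model 1 M := IsManifold.of_le h1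
  have : IsManifold N.model 1 N := IsManifold.of_le h1
  have hf : MDifferentiableAt M.model N.model (f : M → N) (e.symm v) :=
    ((Mfld.contMDiff f).mdifferentiable (by simp)) _
  have hes : MDifferentiableAt M.model M.model e.symm v := mdifferentiableAt_atlas_symm he hv
  have hes' : MDifferentiableAt N.model N.model e'.symm (e' (f (e.symm v))) :=
    mdifferentiableAt_atlas_symm he' (e'.map_source hfv)
  have he1 : MDifferentiableAt N.model N.model e' (f (e.symm v)) :=
    mdifferentiableAt_atlas he' hfv
  have hF : MDifferentiableAt M.model N.model (fun w => e' (f (e.symm w))) v :=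
    he1.comp v (hf.comp v hes)
  have key : (mfderiv N.model N.model e'.symm (e' (f (e.symm v)))).comp
      (mfderiv M.model N.model (fun w => e' (f (e.symm w))) v) =
      (mfderiv M.model N.model (fun w => f (e.symm w)) v) := by
    rw [← mfderiv_comp v hes' hF]
    apply Filter.EventuallyEq.mfderiv_eq
    have hc : ContinuousAt (fun w => f (e.symm w)) v := (hf.comp v hes).continuousAt
    filter_upwards [hc.preimage_mem_nhds (e'.open_source.mem_nhds hfv)] with w hw
    exact e'.left_inv hw
  have key2 := mfderiv_comp v hf hes
  have e3 : e'.symm (e' (f (e.symm v))) = f (e.symm v) := e'.left_inv hfv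
  rw [← mfderiv_eq_fderiv]
  ext w
  have hk : ∀ i, mfderiv M.model N.model (f : M → N) (e.symm v)
      (mfderiv M.model M.model e.symm v (w i)) =
      mfderiv N.model N.model e'.symm (e' (f (e.symm v)))
        (mfderiv M.model N.model (fun w => e' (f (e.symm w))) v (w i)) := by
    intro i
    have a := congrArg (fun T => T (w i)) key
    have b := congrArg (fun T => T (w i)) key2
    exact b.symm.trans a.symm
  have h_eta : ∀ (y y' : N) (_ : y = y') (z : Fin k → EuclideanSpace ℝ (Fin N.dim)),
      (η y : EuclideanSpace ℝ (Fin N.dim) [⋀^Fin k]→L[ℝ] ℝ) z =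
      (η y' : EuclideanSpace ℝ (Fin N.dim) [⋀^Fin k]→L[ℝ] ℝ) z := by
    rintro y _ rfl z; rfl
  refine Eq.trans ?_ (h_eta _ _ e3.symm _)
  exact congrArg (η (f (e.symm v)) : EuclideanSpace ℝ (Fin N.dim) [⋀^Fin k]→L[ℝ] ℝ) (funext hk)

/-- The pullback `f^* η` of a differential form along a smooth map. -/
noncomputable def pullback (f : M ⟶ N) (η : DiffForm N k) : DiffForm M k where
  toFun := pullbackFun f η.toFun
  contDiffOn := by
    intro e he v hv
    set e' := chartAt (EuclideanSpace ℝ (Fin N.dim)) (f (e.symm v)) with hdef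
    have he' : e' ∈ atlas (EuclideanSpace ℝ (Fin N.dim)) N := chart_mem_atlas _ _
    have hfv : f (e.symm v) ∈ e'.source := mem_chart_source _ _
    have hes : ContMDiffAt M.model M.model ∞ e.symm v :=
      (contMDiffOn_symm_of_mem_maximalAtlas
        (IsManifold.subset_maximalAtlas he)).contMDiffAt (e.open_target.mem_nhds hv)
    have hc : ContMDiffAt M.model N.model ∞ (fun w => f (e.symm w)) v :=
      ((Mfld.contMDiff f).contMDiffAt).comp v hes
    have hF : ContDiffAt ℝ ∞ (fun w => e' (f (e.symm w))) v :=
      (ContMDiffAt.comp v (contMDiffAt_of_mem_maximalAtlas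
        (IsManifold.subset_maximalAtlas he') hfv) hc).contDiffAt
    have hD : ContDiffAt ℝ ∞ (fderiv ℝ (fun w => e' (f (e.symm w)))) v :=
      hF.fderiv_right (by norm_cast)
    have h_eta : ContDiffAt ℝ ∞ (chartExpr η.toFun e') (e' (f (e.symm v))) :=
      (η.contDiffOn e' he').contDiffAt (e'.open_target.mem_nhds (e'.map_source hfv))
    have hcomp : ContDiffAt ℝ ∞ (fun w => chartExpr η.toFun e' (e' (f (e.symm w)))) v :=
      ContDiffAt.comp (g := chartExpr η.toFun e') v h_eta hF
    have hmain : ContDiffAt ℝ ∞ (fun v =>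
        (chartExpr η.toFun e' (e' (f (e.symm v)))).compContinuousLinearMap
          (fderiv ℝ (fun w => e' (f (e.symm w))) v)) v :=
      ContDiffAt.comp (f := fun v => (chartExpr η.toFun e' (e' (f (e.symm v))),
        fderiv ℝ (fun w => e' (f (e.symm w))) v)) v contDiff_compContinuousLinearMap.contDiffAt
        (hcomp.prodMk hD)
    refine (hmain.congr_of_eventuallyEq ?_).contDiffWithinAt
    filter_upwards [e.open_target.mem_nhds hv,
      hc.continuousAt.preimage_mem_nhds (e'.open_source.mem_nhds hfv)] with w hw hw'
    exact chartExpr_pullbackFun_eq f η.toFun he he' hw hw'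

theorem pullback_id (η : DiffForm M k) : pullback (𝟙 M) η = η := by
  ext x w
  change η.toFun x (fun i => mfderiv M.model M.model (id : M → M) x (w i)) = η.toFun x w
  simp [mfderiv_id]

theorem pullback_comp (f : M ⟶ N) (g : N ⟶ L) (η : DiffForm L k) :
    pullback (f ≫ g) η = pullback f (pullback g η) := by
  ext x w
  have hf : MDifferentiableAt M.model N.model (f : M → N) x :=
    ((Mfld.contMDiff f).mdifferentiable (by simp)) _
  have hg : MDifferentiableAt N.model L.model (g : N → L) (f x) :=
    ((Mfld.contMDiff g).mdifferentiable (by simp)) _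
  have h := mfderiv_comp x hg hf
  exact congrArg (η.toFun (g (f x))) (funext fun i => congrArg (fun T => T (w i)) h)

end DiffForm

/-- The sheaf `Ω^k` of differential `k`-forms, as a contravariant functor on manifolds. -/
noncomputable def formSheaf (k : ℕ) : Mfld.{u}ᵒᵖ ⥤ Type u where
  obj M := DiffForm M.unop k
  map f := ↾(DiffForm.pullback f.unop)
  map_id M := by
    apply ConcreteCategory.hom_ext
    intro η
    exact DiffForm.pullback_id η
  map_comp f g := by
    apply ConcreteCategory.hom_ext
    intro η
    exact DiffForm.pullback_comp g.unop f.unop η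

/-! ### Categories over manifolds: categories of elements, the Yoneda embedding, forms -/

/-- The category of elements `∫ P` of a presheaf of sets on manifolds, over manifolds: objects are
pairs `(N, x)` with `x ∈ P(N)`, arrows `(N, x) ⟶ (N', x')` are smooth maps `f : N ⟶ N'` with
`P(f)(x') = x`. -/
noncomputable def elementsOver (P : Mfld.{u}ᵒᵖ ⥤ Type u) : BasedCategory.{u, u + 1} Mfld.{u} where
  obj := P.Elementsᵒᵖ
  p := (CategoryOfElements.π P).leftOp

/-- The Yoneda embedding `y` of manifolds into stacks, on objects. The objects of `y(X)` over `N`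
are the smooth maps `N ⟶ X`. -/
noncomputable def yo (X : Mfld.{u}) : BasedCategory.{u, u + 1} Mfld.{u} := elementsOver (yoneda.obj X)

/-- A smooth map `r : N ⟶ X`, as an object of `y(X)` over `N`. -/
noncomputable def yoObj {N X : Mfld.{u}} (r : N ⟶ X) : (yo X).obj :=
  op ((yoneda.obj X).elementsMk (op N) r)

/-- A smooth map `w : L ⟶ N` with `r ∘ w = r'`, as an arrow of `y(X)`. -/
noncomputable def yoMap {L N X : Mfld.{u}} {r' : L ⟶ X} {r : N ⟶ X} (w : L ⟶ N) (h : w ≫ r = r') :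
    yoObj r' ⟶ yoObj r :=
  Quiver.Hom.op (CategoryOfElements.homMk
    ((yoneda.obj X).elementsMk (op N) r) ((yoneda.obj X).elementsMk (op L) r') w.op h)

/-- The `k`-forms on a category `𝒳` over manifolds (in particular on a stack): the maps
`𝒳 ⟶ ∫ Ω^k` over manifolds. -/
abbrev StackForm (𝒳 : BasedCategory.{u, u + 1} Mfld.{u}) (k : ℕ) : Type (u + 1) :=
  BasedFunctor 𝒳 (elementsOver (formSheaf.{u} k))

/-- The differential form on `X` that corresponds to a map `β : y(X) ⟶ ∫ Ω^k` under the Yoneda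
lemma, that is, the value of `β` at the identity of `X`. The pullback along `eqToHom` only
identifies `X` with the base of this value, which is equal to `X`. -/
noncomputable def yonedaForm {X : Mfld.{u}} {k : ℕ} (β : StackForm (yo X) k) : DiffForm X k :=
  DiffForm.pullback (eqToHom (β.w_obj (yoObj (𝟙 X))).symm) (β.obj (yoObj (𝟙 X))).unop.2

/-! ### Atlases -/

section Atlas

variable {𝒳 : BasedCategory.{u, u + 1} Mfld.{u}} {X : Mfld.{u}}

/-- Let `θ : y(X) ⟶ 𝒳` be a map of categories over manifolds and `P` an object of `𝒳` over `M`,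
which is the same as a map `y(M) ⟶ 𝒳`. The manifold `N` with the projections `q : N ⟶ M` and
`r : N ⟶ X` and the arrow `φ : θ(r) ⟶ P` over `q` (that is, the identification of `θ(r)` with
`q^* P`) represents the fibre product of `y(M)` and `y(X)` over `𝒳`: every other such collection
`(L, h, r', φ')` is obtained from it by a unique smooth map `L ⟶ N`. -/
structure RepresentsFibreProduct (θ : BasedFunctor (yo X) 𝒳) {P : 𝒳.obj} {M N : Mfld.{u}}
    (q : N ⟶ M) (r : N ⟶ X) (φ : θ.obj (yoObj r) ⟶ P) : Prop where
  isHomLift : 𝒳.p.IsHomLift q φ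
  existsUnique : ∀ (L : Mfld.{u}) (h : L ⟶ M) (r' : L ⟶ X) (φ' : θ.obj (yoObj r') ⟶ P),
    𝒳.p.IsHomLift h φ' →
    ∃! w : L ⟶ N, w ≫ q = h ∧ ∃ hr : w ≫ r = r', θ.map (yoMap w hr) ≫ φ = φ'

/-- `θ : y(X) ⟶ 𝒳` is an atlas: for every map `y(M) ⟶ 𝒳` the fibre product of `y(M)` and `y(X)`
over `𝒳` is representable by a manifold whose projection to `M` is a surjective submersion. -/
def IsStackAtlas (θ : BasedFunctor (yo X) 𝒳) : Prop :=
  ∀ P : 𝒳.obj, ∃ (N : Mfld.{u}) (q : N ⟶ 𝒳.p.obj P) (r : N ⟶ X) (φ : θ.obj (yoObj r) ⟶ P),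
    RepresentsFibreProduct θ q r φ ∧ Function.Surjective q ∧
      IsSubmersion N.model (𝒳.p.obj P).model ∞ (q : N → 𝒳.p.obj P)

end Atlas

/-! ### Lie groupoids -/

/-- A Lie groupoid. The product `mul g h` is meaningful only if `src g = tgt h`. Smoothness of the
multiplication is smoothness on the submanifold of composable pairs of `Arr × Arr`. -/
structure LieGroupoid : Type (u + 1) where
  Obj : Mfld.{u}
  Arr : Mfld.{u}
  src : Arr ⟶ Obj
  tgt : Arr ⟶ Obj
  unit : Obj ⟶ Arr
  inv : Arr ⟶ Arr
  mul : Arr → Arr → Arr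
  src_submersion : IsSubmersion Arr.model Obj.model ∞ (src : Arr → Obj)
  tgt_submersion : IsSubmersion Arr.model Obj.model ∞ (tgt : Arr → Obj)
  mul_smooth : ContMDiffOn (Arr.model.prod Arr.model) Arr.model ∞
    (fun x : Arr × Arr => mul x.1 x.2) {x | src x.1 = tgt x.2}
  src_unit : ∀ x, src (unit x) = x
  tgt_unit : ∀ x, tgt (unit x) = x
  src_mul : ∀ g h, src g = tgt h → src (mul g h) = src h
  tgt_mul : ∀ g h, src g = tgt h → tgt (mul g h) = tgt g
  mul_assoc : ∀ g h l, src g = tgt h → src h = tgt l → mul (mul g h) l = mul g (mul h l)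
  unit_mul : ∀ g, mul (unit (tgt g)) g = g
  mul_unit : ∀ g, mul g (unit (src g)) = g
  src_inv : ∀ g, src (inv g) = tgt g
  tgt_inv : ∀ g, tgt (inv g) = src g
  inv_mul : ∀ g, mul (inv g) g = unit (src g)
  mul_inv : ∀ g, mul g (inv g) = unit (tgt g)

/-- The basic `k`-forms on the manifold of objects. -/
def basicForms (G : LieGroupoid.{u}) (k : ℕ) : Set (DiffForm G.Obj k) :=
  {μ | DiffForm.pullback G.src μ = DiffForm.pullback G.tgt μ}

/-! ### Principal bundles and the classifying stack -/

/-- A (right) principal `G`-bundle `proj : total ⟶ base`, with anchor map `anchor : total ⟶ Obj`.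
The point `act p g` is meaningful only if `anchor p = tgt g`. The last field says that
`(p, g) ↦ (p, p · g)`, from the pairs with `anchor p = tgt g` to the pairs of points in the same
fibre of `proj`, has the smooth inverse `(p, p') ↦ (p, δ p p')`, hence is a diffeomorphism. -/
structure PrincipalBundle (G : LieGroupoid.{u}) : Type (u + 1) where
  base : Mfld.{u}
  total : Mfld.{u}
  proj : total ⟶ base
  anchor : total ⟶ G.Obj
  act : total → G.Arr → total
  proj_surjective : Function.Surjective proj
  proj_submersion : IsSubmersion total.model base.model ∞ (proj : total → base)
  act_smooth : ContMDiffOn (total.model.prod G.Arr.model) total.model ∞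
    (fun x : total × G.Arr => act x.1 x.2) {x | anchor x.1 = G.tgt x.2}
  anchor_act : ∀ p g, anchor p = G.tgt g → anchor (act p g) = G.src g
  act_unit : ∀ p, act p (G.unit (anchor p)) = p
  act_mul : ∀ p g h, anchor p = G.tgt g → G.src g = G.tgt h →
    act p (G.mul g h) = act (act p g) h
  proj_act : ∀ p g, anchor p = G.tgt g → proj (act p g) = proj p
  principal : ∃ δ : total → total → G.Arr,
    ContMDiffOn (total.model.prod total.model) G.Arr.model ∞
      (fun x : total × total => δ x.1 x.2) {x | proj x.1 = proj x.2} ∧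
    (∀ p p', proj p = proj p' → anchor p = G.tgt (δ p p') ∧ act p (δ p p') = p') ∧
    ∀ p g, anchor p = G.tgt g → δ p (act p g) = g

namespace PrincipalBundle

variable {G : LieGroupoid.{u}}

/-- A map of principal bundles: a smooth equivariant map of the total spaces, over a smooth map of
the bases. -/
@[ext]
structure Hom (P Q : PrincipalBundle G) : Type u where
  baseMap : P.base ⟶ Q.base
  totalMap : P.total ⟶ Q.total
  proj_comm : ∀ p, Q.proj (totalMap p) = baseMap (P.proj p)
  anchor_comm : ∀ p, Q.anchor (totalMap p) = P.anchor p
  act_comm : ∀ p g, P.anchor p = G.tgt g → totalMap (P.act p g) = Q.act (totalMap p) g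

noncomputable instance : Category.{u} (PrincipalBundle G) where
  Hom := Hom
  id P :=
    { baseMap := 𝟙 _
      totalMap := 𝟙 _
      proj_comm := fun _ => rfl
      anchor_comm := fun _ => rfl
      act_comm := fun _ _ _ => rfl }
  comp {P Q R} a b :=
    { baseMap := a.baseMap ≫ b.baseMap
      totalMap := a.totalMap ≫ b.totalMap
      proj_comm := fun p =>
        (b.proj_comm (a.totalMap p)).trans (congrArg b.baseMap (a.proj_comm p))
      anchor_comm := fun p => (b.anchor_comm (a.totalMap p)).trans (a.anchor_comm p)
      act_comm := fun p g h =>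
        (congrArg b.totalMap (a.act_comm p g h)).trans
          (b.act_comm (a.totalMap p) g ((a.anchor_comm p).trans h)) }

/-- The unit bundle: the target map `Arr ⟶ Obj` with anchor the source map, on which `G` acts by
multiplication from the right. -/
noncomputable def unitBundle (G : LieGroupoid.{u}) : PrincipalBundle G where
  base := G.Obj
  total := G.Arr
  proj := G.tgt
  anchor := G.src
  act := G.mul
  proj_surjective x := ⟨G.unit x, G.tgt_unit x⟩
  proj_submersion := G.tgt_submersion
  act_smooth := G.mul_smooth
  anchor_act := G.src_mul
  act_unit := G.mul_unit
  act_mul p g h h1 h2 := (G.mul_assoc p g h h1 h2).symm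
  proj_act := G.tgt_mul
  principal := by
    refine ⟨fun p p' => G.mul (G.inv p) p', ?_, ?_, ?_⟩
    · have hm : ContMDiff (G.Arr.model.prod G.Arr.model) (G.Arr.model.prod G.Arr.model) ∞
          (fun x : G.Arr × G.Arr => ((G.inv x.1 : G.Arr), x.2)) :=
        ((Mfld.contMDiff G.inv).comp contMDiff_fst).prodMk contMDiff_snd
      exact G.mul_smooth.comp hm.contMDiffOn fun x hx => (G.src_inv x.1).trans hx
    · intro p p' h
      have h' : G.src (G.inv p) = G.tgt p' := (G.src_inv p).trans h
      refine ⟨by rw [G.tgt_mul _ _ h', G.tgt_inv], ?_⟩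
      change G.mul p (G.mul (G.inv p) p') = p'
      rw [← G.mul_assoc p (G.inv p) p' (G.tgt_inv p).symm h', G.mul_inv]
      exact (congrArg (fun z => G.mul (G.unit z) p') h).trans (G.unit_mul p')
    · intro p g h
      have h' : G.src p = G.tgt g := h
      change G.mul (G.inv p) (G.mul p g) = g
      rw [← G.mul_assoc (G.inv p) p g (G.src_inv p) h', G.inv_mul, h', G.unit_mul]

end PrincipalBundle

/-- The stack `BG` of principal `G`-bundles, over manifolds. -/
noncomputable def classifyingStack (G : LieGroupoid.{u}) : BasedCategory.{u, u + 1} Mfld.{u} where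
  obj := PrincipalBundle G
  p :=
    { obj := fun P => P.base
      map := fun a => PrincipalBundle.Hom.baseMap a }

/-- `θ : y(Obj) ⟶ BG` is the standard map (determined up to isomorphism, by the Yoneda lemma): it
sends the identity of `Obj` to the unit bundle, hence `f : N ⟶ Obj` to its pullback along `f`. -/
def IsStandardMap {G : LieGroupoid.{u}} (θ : BasedFunctor (yo G.Obj) (classifyingStack G)) :
    Prop :=
  ∃ e : θ.obj (yoObj (𝟙 G.Obj)) ≅ (PrincipalBundle.unitBundle G : (classifyingStack G).obj),
    (classifyingStack G).p.IsHomLift (𝟙 G.Obj) e.hom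

/-- The atlas `θ : y(Obj) ⟶ BG` has `Arr`, with the projections `src` and `tgt` to `Obj`, as the
fibre product of `y(Obj)` with itself over `BG`. -/
def Presents {G : LieGroupoid.{u}} (θ : BasedFunctor (yo G.Obj) (classifyingStack G)) : Prop :=
  ∃ φ : θ.obj (yoObj G.tgt) ⟶ θ.obj (yoObj (𝟙 G.Obj)), RepresentsFibreProduct θ G.src G.tgt φ

/-! A form `α` on `BG` assigns to every principal bundle `P` a form on its base, compatibly with
pullbacks (`StackForm.ext_value`, `StackForm.exists_value_eq`). An atlas `θ : y(Obj) ⟶ BG` provides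
for each `P` a surjective submersion `q : N ⟶ P.base` and a map `r : N ⟶ Obj` such that `q^* P` is
identified with `θ(r)`. If `μ` is the form on `Obj` that corresponds to `α ∘ θ`, then the value of
`α` at `P` pulls back along `q` to `r^* μ`. Since `q^*` is injective on forms
(`DiffForm.pullback_injective`), `μ` determines `α`. Conversely, `r^* μ` descends to `P.base` as soon
as its two pullbacks to the kernel pair `N ×_M N` agree (`DiffForm.exists_pullback_eq`). The two maps
from the kernel pair to `Obj` become isomorphic in `BG`, because all maps of principal bundles are
cartesian (`PrincipalBundle.Hom.exists_lift`). If `Arr` represents the fibre product of `y(Obj)` with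
itself, they are therefore the source and the target of a smooth map to `Arr`
(`Presents.exists_arrow`), and the two pullbacks agree when `μ` is basic. That `μ` is always basic
follows by evaluating `α` at the universal such isomorphism.

The standard map sends `f` to the pullback along `f` of the unit bundle. Its construction needs the
fibre product of a smooth map with a submersion as a manifold (`fibreProduct`), whose charts come
from the normal form of submersions. For any standard map and any principal bundle `P`, the maps from
the pullback of the unit bundle along `r` to `P` correspond to the lifts of `r` along the anchor of
`P`, by evaluation at the units (`PrincipalBundle.existsUnique_section`). Hence the total space of
`P`, with the projection and the anchor, represents the fibre product of `P` with the standard map,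
which is thus an atlas. For the unit bundle this total space is `Arr`, with `tgt` and `src` as
projections, and inversion interchanges the two. -/

/-! ### Smooth maps with values in an embedded submanifold -/

section Submanifold

open Topology

variable {EX HX X : Type*} [NormedAddCommGroup EX] [NormedSpace ℝ EX] [TopologicalSpace HX]
  (J : ModelWithCorners ℝ EX HX) [TopologicalSpace X] [ChartedSpace HX X] (S : Set X) (d : ℕ)

/-- A chart of the subset `S` of the manifold `X` which is compatible with the smooth structure of
`X`: its inverse is smooth as a map to `X`, and the chart itself is the restriction of a smooth map
defined on an open subset of `X`. Any two such charts are smoothly compatible. -/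
def IsSubmanifoldChart (e : OpenPartialHomeomorph S (EuclideanSpace ℝ (Fin d))) : Prop :=
  ContMDiffOn (𝓡 d) J ∞ (fun v => (e.symm v : X)) e.target ∧
    ∃ (E : X → EuclideanSpace ℝ (Fin d)) (U : Set X), IsOpen U ∧ ContMDiffOn J (𝓡 d) ∞ E U ∧
      ∀ s ∈ e.source, (s : X) ∈ U ∧ e s = E s

variable {J S d}

theorem IsSubmanifoldChart.contMDiffWithinAt_comp
    {e : OpenPartialHomeomorph S (EuclideanSpace ℝ (Fin d))} (he : IsSubmanifoldChart J S d e)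
    {EL HL L : Type*} [NormedAddCommGroup EL] [NormedSpace ℝ EL] [TopologicalSpace HL]
    {I : ModelWithCorners ℝ EL HL} [TopologicalSpace L] [ChartedSpace HL L]
    {g : L → S} {A : Set L} {x : L} (hgx : g x ∈ e.source)
    (hg : ContMDiffWithinAt I J ∞ (fun y => (g y : X)) A x) :
    ContMDiffWithinAt I (𝓡 d) ∞ (fun y => e (g y)) A x := by
  obtain ⟨-, E, U, hU, hE, h⟩ := he
  have hc : ContinuousWithinAt g A x :=
    IsInducing.subtypeVal.continuousWithinAt_iff.2 hg.continuousWithinAt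
  have h1 : ContMDiffWithinAt I (𝓡 d) ∞ (fun y => E (g y)) A x :=
    (hE.contMDiffAt (hU.mem_nhds (h _ hgx).1)).comp_contMDiffWithinAt x hg
  refine h1.congr_of_eventuallyEq ?_ (h _ hgx).2
  filter_upwards [hc.preimage_mem_nhdsWithin (e.open_source.mem_nhds hgx)] with y hy
  exact (h _ hy).2

/-- The structure of an embedded submanifold on a subset which is covered by submanifold charts. -/
@[reducible]
noncomputable def submanifoldChartedSpace
    (h : ∀ x : S, ∃ e, IsSubmanifoldChart J S d e ∧ x ∈ e.source) :
    ChartedSpace (EuclideanSpace ℝ (Fin d)) S where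
  atlas := {e | IsSubmanifoldChart J S d e}
  chartAt x := (h x).choose
  mem_chart_source x := (h x).choose_spec.2
  chart_mem_atlas x := (h x).choose_spec.1

theorem isManifold_submanifold (h : ∀ x : S, ∃ e, IsSubmanifoldChart J S d e ∧ x ∈ e.source) :
    letI := submanifoldChartedSpace h
    IsManifold (𝓡 d) ∞ S := by
  let _ := submanifoldChartedSpace h
  refine isManifold_of_contDiffOn (𝓡 d) ∞ S fun e e' he he' v hv => ?_
  have hv' : v ∈ e.target ∧ e.symm v ∈ e'.source := by simpa using hv
  have h1 : ContMDiffAt (𝓡 d) (𝓡 d) ∞ (fun w => e' (e.symm w)) v :=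
    IsSubmanifoldChart.contMDiffWithinAt_comp (J := J) he' hv'.2
      (he.1.contMDiffAt (e.open_target.mem_nhds hv'.1))
  exact h1.contDiffAt.contDiffWithinAt

theorem contMDiff_subtypeVal_submanifold
    (h : ∀ x : S, ∃ e, IsSubmanifoldChart J S d e ∧ x ∈ e.source) :
    letI := submanifoldChartedSpace h
    ContMDiff (𝓡 d) J ∞ (Subtype.val : S → X) := by
  let _ := submanifoldChartedSpace h
  have := isManifold_submanifold h
  intro x
  obtain ⟨e, he, hx⟩ := h x
  have hmax : e ∈ IsManifold.maximalAtlas (𝓡 d) ∞ S := IsManifold.subset_maximalAtlas he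
  have h1 : ContMDiffAt (𝓡 d) J ∞ (fun y => (e.symm (e y) : X)) x :=
    (he.1.contMDiffAt (e.open_target.mem_nhds (e.map_source hx))).comp x
      (contMDiffAt_of_mem_maximalAtlas hmax hx)
  refine h1.congr_of_eventuallyEq ?_
  filter_upwards [e.open_source.mem_nhds hx] with y hy
  rw [e.left_inv hy]

theorem contMDiffWithinAt_submanifold_iff
    (h : ∀ x : S, ∃ e, IsSubmanifoldChart J S d e ∧ x ∈ e.source)
    {EL HL L : Type*} [NormedAddCommGroup EL] [NormedSpace ℝ EL] [TopologicalSpace HL]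
    {I : ModelWithCorners ℝ EL HL} [TopologicalSpace L] [ChartedSpace HL L]
    {g : L → S} {A : Set L} {x : L} :
    letI := submanifoldChartedSpace h
    ContMDiffWithinAt I (𝓡 d) ∞ g A x ↔ ContMDiffWithinAt I J ∞ (fun y => (g y : X)) A x := by
  let _ := submanifoldChartedSpace h
  have := isManifold_submanifold h
  refine ⟨fun hg => (contMDiff_subtypeVal_submanifold h _).comp_contMDiffWithinAt x hg,
    fun hg => ?_⟩
  obtain ⟨e, he, hx⟩ := h (g x)
  have hmax : e ∈ IsManifold.maximalAtlas (𝓡 d) ∞ S := IsManifold.subset_maximalAtlas he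
  rw [contMDiffWithinAt_iff_target_of_mem_maximalAtlas hmax hx]
  exact ⟨IsInducing.subtypeVal.continuousWithinAt_iff.2 hg.continuousWithinAt,
    he.contMDiffWithinAt_comp hx hg⟩

end Submanifold

/-- The composition of a map which is smooth at a point with a map which is smooth on a subset
only, not necessarily open. -/
theorem ContMDiffOn.comp_contMDiffWithinAt_of_eventually {E₁ H₁ M₁ E₂ H₂ M₂ E₃ H₃ M₃ : Type*}
    [NormedAddCommGroup E₁] [NormedSpace ℝ E₁] [TopologicalSpace H₁]
    [NormedAddCommGroup E₂] [NormedSpace ℝ E₂] [TopologicalSpace H₂]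
    [NormedAddCommGroup E₃] [NormedSpace ℝ E₃] [TopologicalSpace H₃]
    {I₁ : ModelWithCorners ℝ E₁ H₁} [TopologicalSpace M₁] [ChartedSpace H₁ M₁]
    {I₂ : ModelWithCorners ℝ E₂ H₂} [TopologicalSpace M₂] [ChartedSpace H₂ M₂]
    {I₃ : ModelWithCorners ℝ E₃ H₃} [TopologicalSpace M₃] [ChartedSpace H₃ M₃]
    {g : M₂ → M₃} {f : M₁ → M₂} {B : Set M₂} {A : Set M₁} {x : M₁}
    (hg : ContMDiffOn I₂ I₃ ∞ g B) (hf : ContMDiffWithinAt I₁ I₂ ∞ f A x)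
    (hx : f x ∈ B) (h : ∀ᶠ y in nhdsWithin x A, f y ∈ B) :
    ContMDiffWithinAt I₁ I₃ ∞ (fun y => g (f y)) A x :=
  ((hg _ hx).comp' x hf).mono_of_mem_nhdsWithin (Filter.inter_mem self_mem_nhdsWithin h)

/-! ### Submersions and fibre products of manifolds -/

section Submersion

open Topology

/-- The normal form of a submersion `p : Q ⟶ M` near a point `q₀`: with the fibre coordinate
`y : Q → F`, the pair `(p, y)` is a diffeomorphism from a neighbourhood of `q₀` onto an open
subset of `M × F`, with inverse `ρ`. -/
theorem exists_submersion_normalForm {F : Type*} [NormedAddCommGroup F] [NormedSpace ℝ F]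
    {Q M : Mfld.{u}} {p : Q ⟶ M} {q₀ : Q}
    (hp : IsSubmersionAtOfComplement F Q.model M.model ∞ (p : Q → M) q₀) :
    ∃ (V : Set Q) (y : Q → F) (W : Set (M × F)) (ρ : M × F → Q),
      IsOpen V ∧ q₀ ∈ V ∧ IsOpen W ∧ ContMDiffOn Q.model 𝓘(ℝ, F) ∞ y V ∧
      ContMDiffOn (M.model.prod 𝓘(ℝ, F)) Q.model ∞ ρ W ∧
      (∀ q ∈ V, (p q, y q) ∈ W ∧ ρ (p q, y q) = q) ∧
      ∀ w ∈ W, ρ w ∈ V ∧ p (ρ w) = w.1 ∧ y (ρ w) = w.2 := by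
  obtain ⟨φ, ψ, hφ₀, hψ₀, hφ, hψ, hsub, L, hL⟩ := hp
  have key : ∀ v ∈ φ.target, ψ (p (φ.symm v)) = (L v).1 := fun v hv => by
    simpa using hL (x := v) (by simpa using hv)
  have hc : ContMDiffOn (M.model.prod 𝓘(ℝ, F)) 𝓘(ℝ, EuclideanSpace ℝ (Fin Q.dim)) ∞
      (fun w : M × F => L.symm (ψ w.1, w.2)) (Prod.fst ⁻¹' ψ.source) := by
    have h1 : ContMDiffOn (M.model.prod 𝓘(ℝ, F))
        𝓘(ℝ, EuclideanSpace ℝ (Fin M.dim) × F) ∞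
        (fun w : M × F => (ψ w.1, w.2)) (Prod.fst ⁻¹' ψ.source) :=
      ContMDiffOn.prodMk_space ((contMDiffOn_of_mem_maximalAtlas hψ).comp contMDiffOn_fst
        fun _ h => h) contMDiffOn_snd
    exact L.symm.contDiff.contMDiff.comp_contMDiffOn h1
  have hψo : IsOpen (Prod.fst ⁻¹' ψ.source : Set (M × F)) := ψ.open_source.preimage continuous_fst
  refine ⟨φ.source, fun q => (L (φ q)).2, Prod.fst ⁻¹' ψ.source ∩
      (fun w : M × F => L.symm (ψ w.1, w.2)) ⁻¹' φ.target,
    fun w => φ.symm (L.symm (ψ w.1, w.2)), φ.open_source, hφ₀,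
    hc.continuousOn.isOpen_inter_preimage hψo φ.open_target, ?_, ?_, ?_, ?_⟩
  · have h1 : ContDiff ℝ ∞ (fun v => (L v).2) := contDiff_snd.comp L.contDiff
    exact h1.contMDiff.comp_contMDiffOn (contMDiffOn_of_mem_maximalAtlas hφ)
  · exact (contMDiffOn_symm_of_mem_maximalAtlas hφ).comp (hc.mono inter_subset_left)
      inter_subset_right
  · intro q hq
    have h1 : L.symm (ψ (p q), (L (φ q)).2) = φ q := by
      have := key (φ q) (φ.map_source hq)
      rw [φ.left_inv hq] at this
      rw [this, Prod.mk.eta, L.symm_apply_apply]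
    refine ⟨⟨hsub hq, ?_⟩, ?_⟩
    · change L.symm (ψ (p q), (L (φ q)).2) ∈ φ.target
      rw [h1]
      exact φ.map_source hq
    · change φ.symm (L.symm (ψ (p q), (L (φ q)).2)) = q
      rw [h1, φ.left_inv hq]
  · rintro ⟨m, z⟩ ⟨hm, hz⟩
    change m ∈ ψ.source at hm
    change L.symm (ψ m, z) ∈ φ.target at hz
    have h0 : φ.symm (L.symm (ψ m, z)) ∈ φ.source := φ.map_target hz
    refine ⟨h0, ψ.injOn (hsub h0) hm ?_, ?_⟩
    · change ψ (p (φ.symm (L.symm (ψ m, z)))) = ψ m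
      rw [key _ hz, L.apply_symm_apply]
    · change (L (φ (φ.symm (L.symm (ψ m, z))))).2 = z
      rw [φ.right_inv hz, L.apply_symm_apply]

/-- Through every point of the total space of a submersion passes a smooth local section. -/
theorem exists_localSection {Q M : Mfld.{u}} {p : Q ⟶ M}
    (hp : IsSubmersion Q.model M.model ∞ (p : Q → M)) (q₀ : Q) :
    ∃ (σ : M → Q) (U : Set M), IsOpen U ∧ p q₀ ∈ U ∧ ContMDiffOn M.model Q.model ∞ σ U ∧
      σ (p q₀) = q₀ ∧ ∀ m ∈ U, p (σ m) = m := by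
  obtain ⟨F, _, _, hF⟩ := hp
  obtain ⟨V, y, W, ρ, hV, hq, hW, -, hρ, h1, h2⟩ := exists_submersion_normalForm (hF q₀)
  have hj : ContMDiff M.model (M.model.prod 𝓘(ℝ, F)) ∞ (fun m : M => (m, y q₀)) :=
    contMDiff_id.prodMk contMDiff_const
  refine ⟨fun m => ρ (m, y q₀), {m | (m, y q₀) ∈ W}, hW.preimage hj.continuous, (h1 q₀ hq).1,
    hρ.comp hj.contMDiffOn fun m hm => hm, (h1 q₀ hq).2, fun m hm => (h2 _ hm).2.1⟩

/-- The local model of the fibre product of a smooth map `f : N ⟶ M` with a submersion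
`p : Q ⟶ M` with fibre `F`: near a point `(n₀, q₀)`, the coordinates are those of `N` together
with the fibre coordinates of `p`. -/
theorem exists_fibreProductChart {F : Type*} [NormedAddCommGroup F] [NormedSpace ℝ F]
    {N Q M : Mfld.{u}} (f : N ⟶ M) {p : Q ⟶ M} {n₀ : N} {q₀ : Q} (h₀ : f n₀ = p q₀)
    (hp : IsSubmersionAtOfComplement F Q.model M.model ∞ (p : Q → M) q₀) :
    ∃ (L : EuclideanSpace ℝ (Fin (N.dim + (Q.dim - M.dim))) ≃L[ℝ]
        EuclideanSpace ℝ (Fin N.dim) × F)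
      (e : OpenPartialHomeomorph {x : N × Q | f x.1 = p x.2}
        (EuclideanSpace ℝ (Fin (N.dim + (Q.dim - M.dim))))),
      IsSubmanifoldChart (N.model.prod Q.model) _ _ e ∧ ⟨(n₀, q₀), h₀⟩ ∈ e.source ∧
      (∀ x ∈ e.source, x.1.1 ∈ (chartAt (EuclideanSpace ℝ (Fin N.dim)) n₀).source) ∧
      ∀ v ∈ e.target, chartAt (EuclideanSpace ℝ (Fin N.dim)) n₀ (e.symm v).1.1 = (L v).1 := by
  have hfd : FiniteDimensional ℝ F :=
    Module.Finite.of_surjective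
      ((LinearMap.snd ℝ (EuclideanSpace ℝ (Fin M.dim)) F).comp hp.equiv.toLinearMap)
      (Prod.snd_surjective.comp hp.equiv.surjective)
  have hdim : Module.finrank ℝ (EuclideanSpace ℝ (Fin (N.dim + (Q.dim - M.dim)))) =
      Module.finrank ℝ (EuclideanSpace ℝ (Fin N.dim) × F) := by
    have h1 := hp.equiv.toLinearEquiv.finrank_eq
    rw [Module.finrank_prod, finrank_euclideanSpace_fin, finrank_euclideanSpace_fin] at h1
    rw [Module.finrank_prod, finrank_euclideanSpace_fin, finrank_euclideanSpace_fin, h1,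
      Nat.add_sub_cancel_left]
  let L := ContinuousLinearEquiv.ofFinrankEq hdim
  obtain ⟨V, y, W, ρ, hV, hq, hW, hy, hρ, h1, h2⟩ := exists_submersion_normalForm hp
  let χ := chartAt (EuclideanSpace ℝ (Fin N.dim)) n₀
  have hχ : χ ∈ IsManifold.maximalAtlas N.model ∞ N := IsManifold.chart_mem_maximalAtlas _
  -- The chart is the restriction of `E`, and its inverse is `R`.
  let E : N × Q → EuclideanSpace ℝ (Fin (N.dim + (Q.dim - M.dim))) :=
    fun x => L.symm (χ x.1, y x.2)
  let B : EuclideanSpace ℝ (Fin (N.dim + (Q.dim - M.dim))) → M × F :=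
    fun v => (f (χ.symm (L v).1), (L v).2)
  let R : EuclideanSpace ℝ (Fin (N.dim + (Q.dim - M.dim))) → N × Q :=
    fun v => (χ.symm (L v).1, ρ (B v))
  let T₀ : Set (EuclideanSpace ℝ (Fin (N.dim + (Q.dim - M.dim)))) := {v | (L v).1 ∈ χ.target}
  let T := T₀ ∩ B ⁻¹' W
  have hT₀ : IsOpen T₀ := χ.open_target.preimage (continuous_fst.comp L.continuous)
  have hE : ContMDiffOn (N.model.prod Q.model) (𝓡 (N.dim + (Q.dim - M.dim))) ∞ E
      (χ.source ×ˢ V) := by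
    refine L.symm.contDiff.contMDiff.comp_contMDiffOn (ContMDiffOn.prodMk_space ?_ ?_)
    · exact (contMDiffOn_of_mem_maximalAtlas hχ).comp contMDiffOn_fst fun _ h => h.1
    · exact hy.comp contMDiffOn_snd fun _ h => h.2
  have hL1 : ContMDiff (𝓡 (N.dim + (Q.dim - M.dim))) (𝓡 N.dim) ∞ (fun v => (L v).1) :=
    (contDiff_fst.comp L.contDiff).contMDiff
  have hL2 : ContMDiff (𝓡 (N.dim + (Q.dim - M.dim))) 𝓘(ℝ, F) ∞ (fun v => (L v).2) :=
    (contDiff_snd.comp L.contDiff).contMDiff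
  have hχs : ContMDiffOn (𝓡 (N.dim + (Q.dim - M.dim))) N.model ∞ (fun v => χ.symm (L v).1) T₀ :=
    (contMDiffOn_symm_of_mem_maximalAtlas hχ).comp hL1.contMDiffOn fun _ h => h
  have hB : ContMDiffOn (𝓡 (N.dim + (Q.dim - M.dim))) (M.model.prod 𝓘(ℝ, F)) ∞ B T₀ :=
    ((Mfld.contMDiff f).comp_contMDiffOn hχs).prodMk hL2.contMDiffOn
  have hR : ContMDiffOn (𝓡 (N.dim + (Q.dim - M.dim))) (N.model.prod Q.model) ∞ R T :=
    (hχs.mono inter_subset_left).prodMk (hρ.comp (hB.mono inter_subset_left) fun _ h => h.2)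
  have hRS : ∀ v ∈ T, f (R v).1 = p (R v).2 := fun v hv => (h2 _ hv.2).2.1.symm
  have hRE : ∀ x : N × Q, f x.1 = p x.2 → x.1 ∈ χ.source → x.2 ∈ V → E x ∈ T ∧ R (E x) = x := by
    rintro ⟨n, q⟩ hx hn hq
    have hL : L (E (n, q)) = (χ n, y q) := L.apply_symm_apply _
    have hBx : B (E (n, q)) = (p q, y q) := by
      change (f (χ.symm (L (E (n, q))).1), (L (E (n, q))).2) = _
      rw [hL]
      change (f (χ.symm (χ n)), y q) = _
      rw [χ.left_inv hn]
      exact congrArg (fun z => (z, y q)) hx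
    refine ⟨⟨?_, ?_⟩, ?_⟩
    · change (L (E (n, q))).1 ∈ χ.target
      rw [hL]
      exact χ.map_source hn
    · change B (E (n, q)) ∈ W
      rw [hBx]
      exact (h1 q hq).1
    · change (χ.symm (L (E (n, q))).1, ρ (B (E (n, q)))) = _
      rw [hBx, hL, (h1 q hq).2]
      exact congrArg (fun z => (z, q)) (χ.left_inv hn)
  have hER : ∀ v ∈ T, ((R v).1 ∈ χ.source ∧ (R v).2 ∈ V) ∧ E (R v) = v := by
    intro v hv
    refine ⟨⟨χ.map_target hv.1, (h2 _ hv.2).1⟩, ?_⟩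
    change L.symm (χ (χ.symm (L v).1), y (ρ (B v))) = v
    rw [χ.right_inv hv.1, (h2 _ hv.2).2.2, Prod.mk.eta, L.symm_apply_apply]
  classical
  let g : EuclideanSpace ℝ (Fin (N.dim + (Q.dim - M.dim))) → {x : N × Q | f x.1 = p x.2} :=
    fun v => if h : v ∈ T then ⟨R v, hRS v h⟩ else ⟨(n₀, q₀), h₀⟩
  have hg : ∀ v ∈ T, (g v : N × Q) = R v := fun v hv => by simp only [g, dif_pos hv]
  have hgR : ContMDiffOn (𝓡 (N.dim + (Q.dim - M.dim))) (N.model.prod Q.model) ∞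
      (fun v => (g v : N × Q)) T := hR.congr hg
  let e : OpenPartialHomeomorph {x : N × Q | f x.1 = p x.2}
      (EuclideanSpace ℝ (Fin (N.dim + (Q.dim - M.dim)))) :=
    { toFun := fun x => E x
      invFun := g
      source := {x | x.1.1 ∈ χ.source ∧ x.1.2 ∈ V}
      target := T
      map_source' := fun x hx => (hRE x x.2 hx.1 hx.2).1
      map_target' := fun v hv => by
        change (g v).1.1 ∈ χ.source ∧ (g v).1.2 ∈ V
        rw [hg v hv]
        exact (hER v hv).1
      left_inv' := fun x hx => Subtype.ext
        ((hg _ (hRE x x.2 hx.1 hx.2).1).trans (hRE x x.2 hx.1 hx.2).2)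
      right_inv' := fun v hv => by
        rw [hg v hv]
        exact (hER v hv).2
      open_source := (χ.open_source.prod hV).preimage continuous_subtype_val
      open_target := hB.continuousOn.isOpen_inter_preimage hT₀ hW
      continuousOn_toFun := hE.continuousOn.comp continuous_subtype_val.continuousOn fun _ h => h
      continuousOn_invFun := IsInducing.subtypeVal.continuousOn_iff.2 hgR.continuousOn }
  refine ⟨L, e, ⟨hgR, E, χ.source ×ˢ V, χ.open_source.prod hV, hE, fun x hx => ⟨hx, rfl⟩⟩,
    ⟨mem_chart_source _ n₀, hq⟩, fun x hx => hx.1, fun v hv => ?_⟩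
  change χ (g v).1.1 = _
  rw [hg v hv]
  exact χ.right_inv hv.1

variable {N Q M : Mfld.{u}}

theorem exists_fibreProductChart_mem (f : N ⟶ M) {p : Q ⟶ M}
    (hp : IsSubmersion Q.model M.model ∞ (p : Q → M)) (x : {x : N × Q | f x.1 = p x.2}) :
    ∃ e, IsSubmanifoldChart (N.model.prod Q.model) {x : N × Q | f x.1 = p x.2}
      (N.dim + (Q.dim - M.dim)) e ∧ x ∈ e.source := by
  obtain ⟨F, _, _, hF⟩ := hp
  obtain ⟨-, e, he, hx, -⟩ := exists_fibreProductChart f x.2 (hF x.1.2)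
  exact ⟨e, he, hx⟩

/-- The fibre product `N ×_M Q` of a smooth map `f : N ⟶ M` with a submersion `p : Q ⟶ M`, an
embedded submanifold of `N × Q`. If it is empty, then its dimension is a junk value. -/
noncomputable def fibreProduct (f : N ⟶ M) (p : Q ⟶ M)
    (hp : IsSubmersion Q.model M.model ∞ (p : Q → M)) : Mfld.{u} :=
  letI := submanifoldChartedSpace (exists_fibreProductChart_mem f hp)
  haveI := isManifold_submanifold (exists_fibreProductChart_mem f hp)
  { carrier := {x : N × Q | f x.1 = p x.2}
    dim := N.dim + (Q.dim - M.dim) }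

namespace fibreProduct

variable {f : N ⟶ M} {p : Q ⟶ M} {hp : IsSubmersion Q.model M.model ∞ (p : Q → M)}

/-- The point of the fibre product with given components. -/
def mk (n : N) (q : Q) (h : f n = p q) : fibreProduct f p hp := ⟨(n, q), h⟩

/-- The projection of the fibre product to the first factor. -/
noncomputable def fst (f : N ⟶ M) (p : Q ⟶ M)
    (hp : IsSubmersion Q.model M.model ∞ (p : Q → M)) : fibreProduct f p hp ⟶ N :=
  ⟨fun x => x.1.1, contMDiff_fst.comp (contMDiff_subtypeVal_submanifold _)⟩

/-- The projection of the fibre product to the second factor. -/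
noncomputable def snd (f : N ⟶ M) (p : Q ⟶ M)
    (hp : IsSubmersion Q.model M.model ∞ (p : Q → M)) : fibreProduct f p hp ⟶ Q :=
  ⟨fun x => x.1.2, contMDiff_snd.comp (contMDiff_subtypeVal_submanifold _)⟩

theorem condition (x : fibreProduct f p hp) : f (fst f p hp x) = p (snd f p hp x) := x.2

theorem ext {x x' : fibreProduct f p hp} (h : fst f p hp x = fst f p hp x')
    (h' : snd f p hp x = snd f p hp x') : x = x' := Subtype.ext (Prod.ext h h')

/-- A map to the fibre product is smooth if its two components are. -/
theorem contMDiffWithinAt {EL HL L : Type*} [NormedAddCommGroup EL] [NormedSpace ℝ EL]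
    [TopologicalSpace HL] {I : ModelWithCorners ℝ EL HL} [TopologicalSpace L] [ChartedSpace HL L]
    {g : L → fibreProduct f p hp} {A : Set L} {x : L}
    (h1 : ContMDiffWithinAt I N.model ∞ (fun y => fst f p hp (g y)) A x)
    (h2 : ContMDiffWithinAt I Q.model ∞ (fun y => snd f p hp (g y)) A x) :
    ContMDiffWithinAt I (fibreProduct f p hp).model ∞ g A x :=
  (contMDiffWithinAt_submanifold_iff (exists_fibreProductChart_mem f hp)).2 (h1.prodMk h2)

theorem isSubmersion_fst (f : N ⟶ M) (p : Q ⟶ M)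
    (hp : IsSubmersion Q.model M.model ∞ (p : Q → M)) :
    IsSubmersion (fibreProduct f p hp).model N.model ∞
      (fst f p hp : fibreProduct f p hp → N) := by
  obtain ⟨F, _, _, hF⟩ := id hp
  refine IsSubmersionOfComplement.isSubmersion (F := F) fun x => ?_
  obtain ⟨L, e, he, hx, hsub, hL⟩ := exists_fibreProductChart f (condition x) (hF _)
  let e' : OpenPartialHomeomorph (fibreProduct f p hp)
    (EuclideanSpace ℝ (Fin (fibreProduct f p hp).dim)) := e
  have he' : e' ∈ IsManifold.maximalAtlas (fibreProduct f p hp).model ∞ (fibreProduct f p hp) :=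
    IsManifold.subset_maximalAtlas he
  refine IsSubmersionAtOfComplement.mk_of_charts L e' (chartAt _ (fst f p hp x)) hx
    (mem_chart_source _ _) he' (IsManifold.chart_mem_maximalAtlas _) hsub fun v hv => ?_
  have hv' : v ∈ e'.target := by simpa using hv
  exact hL v hv'

end fibreProduct

end Submersion

/-! ### Descent of differential forms along surjective submersions -/

namespace DiffForm

open Topology Filter

variable {L M N : Mfld.{u}} {k : ℕ}

/-- The pullback of a field of alternating forms along a map of which no smoothness is required.
It depends only on the germ of the map at the point. -/
noncomputable def pullbackAlong (σ : M → N)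
    (η : ∀ y : N, TangentSpace N.model y [⋀^Fin k]→L[ℝ] ℝ) (x : M) :
    TangentSpace M.model x [⋀^Fin k]→L[ℝ] ℝ :=
  (η (σ x)).compContinuousLinearMap (mfderiv M.model N.model σ x)

theorem apply_eq_of_eq (η : ∀ y : N, TangentSpace N.model y [⋀^Fin k]→L[ℝ] ℝ) {y y' : N}
    (h : y = y') (z : Fin k → EuclideanSpace ℝ (Fin N.dim)) :
    (η y : EuclideanSpace ℝ (Fin N.dim) [⋀^Fin k]→L[ℝ] ℝ) z =
      (η y' : EuclideanSpace ℝ (Fin N.dim) [⋀^Fin k]→L[ℝ] ℝ) z := by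
  subst h; rfl

theorem pullbackAlong_congr {σ τ : M → N} {x : M} (h : σ =ᶠ[𝓝 x] τ)
    (η : ∀ y : N, TangentSpace N.model y [⋀^Fin k]→L[ℝ] ℝ) :
    pullbackAlong σ η x = pullbackAlong τ η x := by
  have h1 : mfderiv M.model N.model σ x = mfderiv M.model N.model τ x := h.mfderiv_eq
  ext w
  refine Eq.trans ?_ (apply_eq_of_eq η h.eq_of_nhds _)
  exact congrArg (η (σ x) : EuclideanSpace ℝ (Fin N.dim) [⋀^Fin k]→L[ℝ] ℝ)
    (funext fun i => congrArg (fun T : EuclideanSpace ℝ (Fin M.dim) →L[ℝ]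
      EuclideanSpace ℝ (Fin N.dim) => T (w i)) h1)

theorem pullbackAlong_comp {σ : L → M} {τ : M → N} {x : L}
    (hσ : ContMDiffAt L.model M.model ∞ σ x) (hτ : ContMDiffAt M.model N.model ∞ τ (σ x))
    (η : ∀ y : N, TangentSpace N.model y [⋀^Fin k]→L[ℝ] ℝ) :
    pullbackAlong (fun y => τ (σ y)) η x = pullbackAlong σ (pullbackAlong τ η) x := by
  ext w
  have h := mfderiv_comp x (hτ.mdifferentiableAt (by simp)) (hσ.mdifferentiableAt (by simp))
  exact congrArg (η (τ (σ x))) (funext fun i => congrArg (fun T => T (w i)) h)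

theorem pullbackAlong_eq_self {σ : M → M} {x : M} (h : ∀ᶠ y in 𝓝 x, σ y = y)
    (η : ∀ y : M, TangentSpace M.model y [⋀^Fin k]→L[ℝ] ℝ) :
    pullbackAlong σ η x = η x := by
  refine (pullbackAlong_congr (τ := id) h η).trans ?_
  ext w
  change η x (fun i => mfderiv M.model M.model (id : M → M) x (w i)) = η x w
  simp [mfderiv_id]

theorem chartExpr_pullbackAlong_eq {σ : M → N}
    (η : ∀ x : N, TangentSpace N.model x [⋀^Fin k]→L[ℝ] ℝ)
    {e : OpenPartialHomeomorph M (EuclideanSpace ℝ (Fin M.dim))}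
    (he : e ∈ atlas (EuclideanSpace ℝ (Fin M.dim)) M)
    {e' : OpenPartialHomeomorph N (EuclideanSpace ℝ (Fin N.dim))}
    (he' : e' ∈ atlas (EuclideanSpace ℝ (Fin N.dim)) N)
    {v : EuclideanSpace ℝ (Fin M.dim)} (hv : v ∈ e.target)
    (hσ : ContMDiffAt M.model N.model ∞ σ (e.symm v)) (hfv : σ (e.symm v) ∈ e'.source) :
    chartExpr (pullbackAlong σ η) e v =
      (chartExpr η e' (e' (σ (e.symm v)))).compContinuousLinearMap
        (fderiv ℝ (fun w => e' (σ (e.symm w))) v) := by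
  have h1 : (1 : ℕ∞ω) ≤ ∞ := by exact_mod_cast le_top
  have : IsManifold M.model 1 M := IsManifold.of_le h1
  have : IsManifold N.model 1 N := IsManifold.of_le h1
  have hf : MDifferentiableAt M.model N.model σ (e.symm v) := hσ.mdifferentiableAt (by simp)
  have hes : MDifferentiableAt M.model M.model e.symm v := mdifferentiableAt_atlas_symm he hv
  have hes' : MDifferentiableAt N.model N.model e'.symm (e' (σ (e.symm v))) :=
    mdifferentiableAt_atlas_symm he' (e'.map_source hfv)
  have hF : MDifferentiableAt M.model N.model (fun w => e' (σ (e.symm w))) v :=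
    (mdifferentiableAt_atlas he' hfv).comp v (hf.comp v hes)
  have key : (mfderiv N.model N.model e'.symm (e' (σ (e.symm v)))).comp
      (mfderiv M.model N.model (fun w => e' (σ (e.symm w))) v) =
      (mfderiv M.model N.model (fun w => σ (e.symm w)) v) := by
    rw [← mfderiv_comp v hes' hF]
    apply Filter.EventuallyEq.mfderiv_eq
    have hc : ContinuousAt (fun w => σ (e.symm w)) v := (hf.comp v hes).continuousAt
    filter_upwards [hc.preimage_mem_nhds (e'.open_source.mem_nhds hfv)] with w hw
    exact e'.left_inv hw
  have key2 := mfderiv_comp v hf hes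
  rw [← mfderiv_eq_fderiv]
  ext w
  have hk : ∀ i, mfderiv M.model N.model σ (e.symm v)
      (mfderiv M.model M.model e.symm v (w i)) =
      mfderiv N.model N.model e'.symm (e' (σ (e.symm v)))
        (mfderiv M.model N.model (fun w => e' (σ (e.symm w))) v (w i)) := by
    intro i
    have a := congrArg (fun T => T (w i)) key
    have b := congrArg (fun T => T (w i)) key2
    exact b.symm.trans a.symm
  refine Eq.trans ?_ (apply_eq_of_eq η (e'.left_inv hfv).symm _)
  exact congrArg (η (σ (e.symm v)) : EuclideanSpace ℝ (Fin N.dim) [⋀^Fin k]→L[ℝ] ℝ) (funext hk)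

theorem contDiffAt_chartExpr_pullbackAlong {σ : M → N} {U : Set M} (hU : IsOpen U)
    (hσ : ContMDiffOn M.model N.model ∞ σ U) (η : DiffForm N k)
    {e : OpenPartialHomeomorph M (EuclideanSpace ℝ (Fin M.dim))}
    (he : e ∈ atlas (EuclideanSpace ℝ (Fin M.dim)) M)
    {v : EuclideanSpace ℝ (Fin M.dim)} (hv : v ∈ e.target) (hvU : e.symm v ∈ U) :
    ContDiffAt ℝ ∞ (chartExpr (pullbackAlong σ η.toFun) e) v := by
  set e' := chartAt (EuclideanSpace ℝ (Fin N.dim)) (σ (e.symm v)) with hdef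
  have he' : e' ∈ atlas (EuclideanSpace ℝ (Fin N.dim)) N := chart_mem_atlas _ _
  have hfv : σ (e.symm v) ∈ e'.source := mem_chart_source _ _
  have hes : ContMDiffAt M.model M.model ∞ e.symm v :=
    (contMDiffOn_symm_of_mem_maximalAtlas
      (IsManifold.subset_maximalAtlas he)).contMDiffAt (e.open_target.mem_nhds hv)
  have hc : ContMDiffAt M.model N.model ∞ (fun w => σ (e.symm w)) v :=
    (hσ.contMDiffAt (hU.mem_nhds hvU)).comp v hes
  have hF : ContDiffAt ℝ ∞ (fun w => e' (σ (e.symm w))) v :=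
    (ContMDiffAt.comp v (contMDiffAt_of_mem_maximalAtlas
      (IsManifold.subset_maximalAtlas he') hfv) hc).contDiffAt
  have hD : ContDiffAt ℝ ∞ (fderiv ℝ (fun w => e' (σ (e.symm w)))) v :=
    hF.fderiv_right (by norm_cast)
  have h_eta : ContDiffAt ℝ ∞ (chartExpr η.toFun e') (e' (σ (e.symm v))) :=
    (η.contDiffOn e' he').contDiffAt (e'.open_target.mem_nhds (e'.map_source hfv))
  have hcomp : ContDiffAt ℝ ∞ (fun w => chartExpr η.toFun e' (e' (σ (e.symm w)))) v :=
    ContDiffAt.comp (g := chartExpr η.toFun e') v h_eta hF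
  have hmain : ContDiffAt ℝ ∞ (fun v =>
      (chartExpr η.toFun e' (e' (σ (e.symm v)))).compContinuousLinearMap
        (fderiv ℝ (fun w => e' (σ (e.symm w))) v)) v :=
    ContDiffAt.comp (f := fun v => (chartExpr η.toFun e' (e' (σ (e.symm v))),
      fderiv ℝ (fun w => e' (σ (e.symm w))) v)) v contDiff_compContinuousLinearMap.contDiffAt
      (hcomp.prodMk hD)
  refine hmain.congr_of_eventuallyEq ?_
  filter_upwards [e.open_target.mem_nhds hv, hes.continuousAt.preimage_mem_nhds (hU.mem_nhds hvU),
    hc.continuousAt.preimage_mem_nhds (e'.open_source.mem_nhds hfv)] with w hw hwU hw'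
  exact chartExpr_pullbackAlong_eq η.toFun he he' hw (hσ.contMDiffAt (hU.mem_nhds hwU)) hw'

theorem pullback_injective {q : N ⟶ M} (hq : IsSubmersion N.model M.model ∞ (q : N → M))
    (hs : Function.Surjective q) :
    Function.Injective (pullback q : DiffForm M k → DiffForm N k) := by
  intro β β' h
  have key : ∀ (β : DiffForm M k) (σ : M → N) (U : Set M) (m : M), IsOpen U → m ∈ U →
      ContMDiffOn M.model N.model ∞ σ U → (∀ m ∈ U, q (σ m) = m) →
      β.toFun m = pullbackAlong σ (pullback q β).toFun m := by
    intro β σ U m hU hm hσ hσq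
    rw [← pullbackAlong_eq_self (σ := fun m => q (σ m))
      (Filter.mem_of_superset (hU.mem_nhds hm) hσq) β.toFun]
    exact pullbackAlong_comp (hσ.contMDiffAt (hU.mem_nhds hm)) (Mfld.contMDiff q).contMDiffAt _
  apply DiffForm.ext
  funext m
  obtain ⟨n, rfl⟩ := hs m
  obtain ⟨σ, U, hU, hm, hσ, -, hσq⟩ := exists_localSection hq n
  rw [key β σ U _ hU hm hσ hσq, key β' σ U _ hU hm hσ hσq, h]

section Descent

variable {q : N ⟶ M} {hq : IsSubmersion N.model M.model ∞ (q : N → M)} {ν : DiffForm N k}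

/-- Two maps to `N` with the same composite to `M` form a map to the kernel pair `N ×_M N`, so
that a form whose two pullbacks to the kernel pair agree has the same pullbacks along them. -/
theorem pullbackAlong_eq_of_kernelPair
    (hν : pullback (fibreProduct.fst q q hq) ν = pullback (fibreProduct.snd q q hq) ν)
    {a b : L → N} {x : L} (ha : ContMDiffAt L.model N.model ∞ a x)
    (hb : ContMDiffAt L.model N.model ∞ b x) (hab : ∀ᶠ y in 𝓝 x, q (a y) = q (b y)) :
    pullbackAlong a ν.toFun x = pullbackAlong b ν.toFun x := by
  classical
  let g : L → fibreProduct q q hq := fun y =>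
    if h : q (a y) = q (b y) then fibreProduct.mk (a y) (b y) h
    else fibreProduct.mk (a x) (a x) rfl
  have hg : ∀ y, q (a y) = q (b y) →
      fibreProduct.fst q q hq (g y) = a y ∧ fibreProduct.snd q q hq (g y) = b y := by
    intro y h
    simp only [g, dif_pos h]
    exact ⟨rfl, rfl⟩
  have h1 : (fun y => fibreProduct.fst q q hq (g y)) =ᶠ[𝓝 x] a := hab.mono fun y h => (hg y h).1
  have h2 : (fun y => fibreProduct.snd q q hq (g y)) =ᶠ[𝓝 x] b := hab.mono fun y h => (hg y h).2
  have hgs : ContMDiffAt L.model (fibreProduct q q hq).model ∞ g x :=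
    fibreProduct.contMDiffWithinAt (ha.congr_of_eventuallyEq h1) (hb.congr_of_eventuallyEq h2)
  rw [← pullbackAlong_congr h1, ← pullbackAlong_congr h2,
    pullbackAlong_comp hgs (Mfld.contMDiff _).contMDiffAt,
    pullbackAlong_comp hgs (Mfld.contMDiff _).contMDiffAt]
  exact congrArg (fun η : DiffForm _ k => pullbackAlong g η.toFun x) hν

/-- Forms descend along a surjective submersion: locally, the descended form is the pullback along
a section. -/
theorem exists_pullback_eq (hs : Function.Surjective q)
    (hν : pullback (fibreProduct.fst q q hq) ν = pullback (fibreProduct.snd q q hq) ν) :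
    ∃ β : DiffForm M k, pullback q β = ν := by
  have hsec : ∀ m : M, ∃ (σ : M → N) (U : Set M), IsOpen U ∧ m ∈ U ∧
      ContMDiffOn M.model N.model ∞ σ U ∧ ∀ m ∈ U, q (σ m) = m := by
    intro m
    obtain ⟨n, rfl⟩ := hs m
    obtain ⟨σ, U, hU, hm, hσ, -, hσq⟩ := exists_localSection hq n
    exact ⟨σ, U, hU, hm, hσ, hσq⟩
  choose s V hV hmV hsV hsq using hsec
  let β : ∀ m : M, TangentSpace M.model m [⋀^Fin k]→L[ℝ] ℝ :=
    fun m => pullbackAlong (s m) ν.toFun m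
  have hβ : ∀ (σ : M → N) (U : Set M), IsOpen U → ContMDiffOn M.model N.model ∞ σ U →
      (∀ m ∈ U, q (σ m) = m) → ∀ m ∈ U, β m = pullbackAlong σ ν.toFun m := by
    intro σ U hU hσ hσq m hm
    refine pullbackAlong_eq_of_kernelPair hν ((hsV m).contMDiffAt ((hV m).mem_nhds (hmV m)))
      (hσ.contMDiffAt (hU.mem_nhds hm)) ?_
    filter_upwards [(hV m).mem_nhds (hmV m), hU.mem_nhds hm] with y hy hy'
    rw [hsq m y hy, hσq y hy']
  refine ⟨⟨β, fun e he v hv => ContDiffAt.contDiffWithinAt ?_⟩, ?_⟩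
  · have hes : ContinuousAt e.symm v := e.continuousAt_symm hv
    refine (contDiffAt_chartExpr_pullbackAlong (hV (e.symm v)) (hsV _) ν he hv
      (hmV _)).congr_of_eventuallyEq ?_
    filter_upwards [hes.preimage_mem_nhds ((hV _).mem_nhds (hmV _))] with w hw
    change (β (e.symm w)).compContinuousLinearMap _ = _
    rw [hβ _ _ (hV (e.symm v)) (hsV _) (hsq _) _ hw]
    rfl
  · apply DiffForm.ext
    funext n
    have hσ : ContMDiffAt M.model N.model ∞ (s (q n)) (q n) :=
      (hsV _).contMDiffAt ((hV _).mem_nhds (hmV _))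
    have hqn : ContMDiffAt N.model M.model ∞ (q : N → M) n := (Mfld.contMDiff q).contMDiffAt
    refine (pullbackAlong_comp hqn hσ ν.toFun).symm.trans ?_
    refine (pullbackAlong_eq_of_kernelPair (b := id) hν (hσ.comp n hqn) contMDiffAt_id ?_).trans
      (pullbackAlong_eq_self (Eventually.of_forall fun _ => rfl) _)
    filter_upwards [hqn.continuousAt.preimage_mem_nhds ((hV _).mem_nhds (hmV (q n)))] with y hy
    exact hsq (q n) _ hy

end Descent

end DiffForm

/-! ### Maps of principal bundles -/

namespace PrincipalBundle

open Topology

variable {G : LieGroupoid.{u}} {P Q R : PrincipalBundle G}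

theorem act_injective (P : PrincipalBundle G) {p : P.total} {g h : G.Arr}
    (hg : P.anchor p = G.tgt g) (hh : P.anchor p = G.tgt h) (e : P.act p g = P.act p h) :
    g = h := by
  obtain ⟨δ, -, -, hδ⟩ := P.principal
  rw [← hδ p g hg, e, hδ p h hh]

theorem exists_act_eq (P : PrincipalBundle G) {p p' : P.total} (h : P.proj p = P.proj p') :
    ∃ g, P.anchor p = G.tgt g ∧ P.act p g = p' := by
  obtain ⟨δ, -, hδ, -⟩ := P.principal
  exact ⟨δ p p', hδ p p' h⟩

namespace Hom

theorem baseMap_comp (a : P ⟶ Q) (b : Q ⟶ R) :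
    Hom.baseMap (a ≫ b) = Hom.baseMap a ≫ Hom.baseMap b := rfl

theorem ext_totalMap {a b : P ⟶ Q} (h : ∀ z, Hom.totalMap a z = Hom.totalMap b z) : a = b := by
  refine Hom.ext ?_ (ConcreteCategory.hom_ext _ _ h)
  refine ConcreteCategory.hom_ext _ _ fun x => ?_
  obtain ⟨z, rfl⟩ := P.proj_surjective x
  rw [← Hom.proj_comm a, ← Hom.proj_comm b, h]

/-- A map of principal bundles is injective on fibres. -/
theorem totalMap_injOn_fibre (b : Q ⟶ P) {z z' : Q.total} (h : Q.proj z = Q.proj z')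
    (hb : Hom.totalMap b z = Hom.totalMap b z') : z = z' := by
  obtain ⟨g, hg, rfl⟩ := Q.exists_act_eq h
  have hg' : P.anchor (Hom.totalMap b z) = G.tgt g := (Hom.anchor_comm b z).trans hg
  rw [Hom.act_comm b z g hg] at hb
  have : g = G.unit (Q.anchor z) := by
    rw [← Hom.anchor_comm b]
    exact P.act_injective hg' (G.tgt_unit _).symm (hb.symm.trans (P.act_unit _).symm)
  rw [this, Q.act_unit]

/-- A map of principal bundles is surjective on fibres. -/
theorem exists_totalMap_eq (b : Q ⟶ P) {x : Q.base} {p : P.total}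
    (h : P.proj p = Hom.baseMap b x) : ∃ z, Q.proj z = x ∧ Hom.totalMap b z = p := by
  obtain ⟨z, rfl⟩ := Q.proj_surjective x
  obtain ⟨g, hg, rfl⟩ := P.exists_act_eq ((Hom.proj_comm b z).trans h.symm)
  have hg' : Q.anchor z = G.tgt g := (Hom.anchor_comm b z).symm.trans hg
  exact ⟨Q.act z g, Q.proj_act z g hg', Hom.act_comm b z g hg'⟩

theorem eq_of_comp_eq (b : Q ⟶ P) {c c' : R ⟶ Q} (h : Hom.baseMap c = Hom.baseMap c')
    (hb : c ≫ b = c' ≫ b) : c = c' :=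
  ext_totalMap fun z => totalMap_injOn_fibre b
    ((Hom.proj_comm c z).trans ((congrArg (fun k : R.base ⟶ Q.base => k (R.proj z)) h).trans
      (Hom.proj_comm c' z).symm))
    (congrArg (fun k : R ⟶ P => Hom.totalMap k z) hb)

/-- Every map of principal bundles is cartesian over manifolds. Smoothness of the lift is checked
with local sections of the bundle `Q`. -/
theorem exists_lift (b : Q ⟶ P) (a : R ⟶ P) (g : R.base ⟶ Q.base)
    (h : Hom.baseMap a = g ≫ Hom.baseMap b) :
    ∃ c : R ⟶ Q, Hom.baseMap c = g ∧ c ≫ b = a := by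
  have hex : ∀ z : R.total, ∃ y, Q.proj y = g (R.proj z) ∧ Hom.totalMap b y = Hom.totalMap a z :=
    fun z => exists_totalMap_eq b
      ((Hom.proj_comm a z).trans (congrArg (fun k : R.base ⟶ P.base => k (R.proj z)) h))
  choose c hc1 hc2 using hex
  have hc : ContMDiff R.total.model Q.total.model ∞ c := by
    intro z
    obtain ⟨σ, U, hU, hzU, hσ, -, hσq⟩ := exists_localSection Q.proj_submersion (c z)
    rw [hc1] at hzU
    obtain ⟨δ, hδs, hδ, -⟩ := P.principal
    have hgR : ContMDiffAt R.total.model Q.base.model ∞ (fun y => g (R.proj y)) z :=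
      (Mfld.contMDiff (R.proj ≫ g)).contMDiffAt
    have hev : ∀ᶠ y in 𝓝 z, g (R.proj y) ∈ U :=
      hgR.continuousAt.preimage_mem_nhds (hU.mem_nhds hzU)
    have hs : ContMDiffAt R.total.model Q.total.model ∞ (fun y => σ (g (R.proj y))) z :=
      (hσ.contMDiffAt (hU.mem_nhds hzU)).comp z hgR
    have hfib : ∀ y, g (R.proj y) ∈ U →
        P.proj (Hom.totalMap b (σ (g (R.proj y)))) = P.proj (Hom.totalMap a y) := by
      intro y hy
      rw [Hom.proj_comm, hσq _ hy, ← hc2 y, Hom.proj_comm, hc1]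
    have hδc : ContMDiffAt R.total.model G.Arr.model ∞
        (fun y => δ (Hom.totalMap b (σ (g (R.proj y)))) (Hom.totalMap a y)) z :=
      hδs.comp_contMDiffWithinAt_of_eventually
        (((Mfld.contMDiff (Hom.totalMap b)).contMDiffAt.comp z hs).prodMk
          (Mfld.contMDiff (Hom.totalMap a)).contMDiffAt) (hfib z hzU)
        (by rw [nhdsWithin_univ]; exact hev.mono hfib)
    have hanch : ∀ y, g (R.proj y) ∈ U → Q.anchor (σ (g (R.proj y))) =
        G.tgt (δ (Hom.totalMap b (σ (g (R.proj y)))) (Hom.totalMap a y)) := by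
      intro y hy
      rw [← Hom.anchor_comm b]
      exact (hδ _ _ (hfib y hy)).1
    have hact : ContMDiffAt R.total.model Q.total.model ∞ (fun y => Q.act (σ (g (R.proj y)))
        (δ (Hom.totalMap b (σ (g (R.proj y)))) (Hom.totalMap a y))) z :=
      Q.act_smooth.comp_contMDiffWithinAt_of_eventually (hs.prodMk hδc) (hanch z hzU)
        (by rw [nhdsWithin_univ]; exact hev.mono hanch)
    refine hact.congr_of_eventuallyEq (hev.mono fun y hy => ?_)
    refine totalMap_injOn_fibre b ?_ ?_
    · rw [hc1, Q.proj_act _ _ (hanch y hy), hσq _ hy]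
    · rw [hc2, Hom.act_comm b _ _ (hanch y hy)]
      exact (hδ _ _ (hfib y hy)).2.symm
  have hca : ∀ z, Q.anchor (c z) = R.anchor z := fun z => by
    rw [← Hom.anchor_comm b, hc2, Hom.anchor_comm]
  refine ⟨{ baseMap := g
            totalMap := ⟨c, hc⟩
            proj_comm := hc1
            anchor_comm := hca
            act_comm := fun z l hl => ?_ }, rfl, ext_totalMap hc2⟩
  have hl' : Q.anchor (c z) = G.tgt l := (hca z).trans hl
  refine totalMap_injOn_fibre b ?_ ?_
  · change Q.proj (c (R.act z l)) = Q.proj (Q.act (c z) l)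
    rw [hc1, R.proj_act z l hl, Q.proj_act _ l hl', hc1]
  · change Hom.totalMap b (c (R.act z l)) = Hom.totalMap b (Q.act (c z) l)
    rw [hc2, Hom.act_comm a z l hl, Hom.act_comm b _ l hl', hc2]

theorem isIso_of_isIso_baseMap (b : Q ⟶ P) [IsIso (Hom.baseMap b)] : IsIso b := by
  obtain ⟨c, hc, hcb⟩ := exists_lift b (𝟙 P) (inv (Hom.baseMap b)) (IsIso.inv_hom_id _).symm
  refine ⟨c, eq_of_comp_eq b ?_ ?_, hcb⟩
  · rw [baseMap_comp, hc, IsIso.hom_inv_id]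
    rfl
  · rw [Category.assoc, hcb, Category.comp_id, Category.id_comp]

end Hom

/-! ### The pullback of a principal bundle -/

section Pullback

variable (P) {N : Mfld.{u}} (f : N ⟶ P.base)

/-- The total space `N ×_M P` of the pullback `f^* P` of a principal bundle. -/
noncomputable abbrev pullbackTotal : Mfld.{u} := fibreProduct f P.proj P.proj_submersion

/-- The projection of the total space of `f^* P` to the base `N`. -/
noncomputable abbrev pullbackFst : P.pullbackTotal f ⟶ N :=
  fibreProduct.fst f P.proj P.proj_submersion

/-- The projection of the total space of `f^* P` to the total space of `P`. -/
noncomputable abbrev pullbackSnd : P.pullbackTotal f ⟶ P.total :=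
  fibreProduct.snd f P.proj P.proj_submersion

open Classical in
/-- The action of the groupoid on the second component of the points of `f^* P`. -/
noncomputable def pullbackAct (x : P.pullbackTotal f) (g : G.Arr) : P.pullbackTotal f :=
  if h : P.anchor (P.pullbackSnd f x) = G.tgt g then
    fibreProduct.mk (P.pullbackFst f x) (P.act (P.pullbackSnd f x) g)
      ((fibreProduct.condition x).trans (P.proj_act _ g h).symm)
  else x

theorem pullbackFst_act (x : P.pullbackTotal f) (g : G.Arr) :
    P.pullbackFst f (P.pullbackAct f x g) = P.pullbackFst f x := by
  unfold pullbackAct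
  split_ifs <;> rfl

theorem pullbackSnd_act {x : P.pullbackTotal f} {g : G.Arr}
    (h : P.anchor (P.pullbackSnd f x) = G.tgt g) :
    P.pullbackSnd f (P.pullbackAct f x g) = P.act (P.pullbackSnd f x) g := by
  unfold pullbackAct
  rw [dif_pos h]
  rfl

theorem pullbackAct_smooth :
    ContMDiffOn ((P.pullbackTotal f).model.prod G.Arr.model) (P.pullbackTotal f).model ∞
      (fun x : P.pullbackTotal f × G.Arr => P.pullbackAct f x.1 x.2)
      {x | P.anchor (P.pullbackSnd f x.1) = G.tgt x.2} := by
  intro x hx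
  refine fibreProduct.contMDiffWithinAt ?_ ?_
  · have h1 : ContMDiff ((P.pullbackTotal f).model.prod G.Arr.model) N.model ∞
        (fun y : P.pullbackTotal f × G.Arr => P.pullbackFst f y.1) :=
      (Mfld.contMDiff (P.pullbackFst f)).comp contMDiff_fst
    exact (h1 x).contMDiffWithinAt.congr_of_mem (fun y _ => P.pullbackFst_act f y.1 y.2) hx
  · have h1 : ContMDiff ((P.pullbackTotal f).model.prod G.Arr.model)
        (P.total.model.prod G.Arr.model) ∞
        (fun y : P.pullbackTotal f × G.Arr => (P.pullbackSnd f y.1, y.2)) :=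
      ((Mfld.contMDiff (P.pullbackSnd f)).comp contMDiff_fst).prodMk contMDiff_snd
    exact (P.act_smooth.comp h1.contMDiffOn (fun _ h => h) x hx).congr_of_mem
      (fun y hy => P.pullbackSnd_act f hy) hx

/-- The pullback `f^* P` of a principal bundle along a smooth map. -/
noncomputable def pullback : PrincipalBundle G where
  base := N
  total := P.pullbackTotal f
  proj := P.pullbackFst f
  anchor := P.pullbackSnd f ≫ P.anchor
  act := P.pullbackAct f
  proj_surjective n := by
    obtain ⟨p, hp⟩ := P.proj_surjective (f n)
    exact ⟨fibreProduct.mk n p hp.symm, rfl⟩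
  proj_submersion := fibreProduct.isSubmersion_fst _ _ _
  act_smooth := P.pullbackAct_smooth f
  anchor_act x g h := (congrArg P.anchor (P.pullbackSnd_act f h)).trans (P.anchor_act _ g h)
  act_unit x := fibreProduct.ext (P.pullbackFst_act f _ _)
    ((P.pullbackSnd_act f (G.tgt_unit _).symm).trans (P.act_unit _))
  act_mul x g h hg' hgh := by
    have hg : P.anchor (P.pullbackSnd f x) = G.tgt g := hg'
    have h1 : P.anchor (P.pullbackSnd f x) = G.tgt (G.mul g h) :=
      Eq.trans hg (G.tgt_mul g h hgh).symm
    have h2 : P.anchor (P.pullbackSnd f (P.pullbackAct f x g)) = G.tgt h := by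
      rw [P.pullbackSnd_act f hg, P.anchor_act _ g hg, hgh]
    refine fibreProduct.ext ?_ ?_
    · exact (P.pullbackFst_act f _ _).trans
        ((P.pullbackFst_act f _ _).trans (P.pullbackFst_act f _ _)).symm
    · refine (P.pullbackSnd_act f h1).trans (Eq.trans ?_ (P.pullbackSnd_act f h2).symm)
      rw [P.pullbackSnd_act f hg, P.act_mul _ g h hg hgh]
  proj_act x g _ := P.pullbackFst_act f x g
  principal := by
    obtain ⟨δ, hδs, h1, h2⟩ := P.principal
    have hfib : ∀ x x' : P.pullbackTotal f, P.pullbackFst f x = P.pullbackFst f x' →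
        P.proj (P.pullbackSnd f x) = P.proj (P.pullbackSnd f x') := fun x x' h => by
      rw [← fibreProduct.condition, ← fibreProduct.condition, h]
    refine ⟨fun x x' => δ (P.pullbackSnd f x) (P.pullbackSnd f x'), ?_, fun x x' h => ?_,
      fun x g h => ?_⟩
    · have hs := Mfld.contMDiff (P.pullbackSnd f)
      exact hδs.comp ((hs.comp contMDiff_fst).prodMk (hs.comp contMDiff_snd)).contMDiffOn
        fun x hx => hfib _ _ hx
    · have h3 := h1 _ _ (hfib x x' h)
      exact ⟨h3.1, fibreProduct.ext ((P.pullbackFst_act f _ _).trans h)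
        ((P.pullbackSnd_act f h3.1).trans h3.2)⟩
    · exact (congrArg (δ (P.pullbackSnd f x)) (P.pullbackSnd_act f h)).trans (h2 _ g h)

/-- The projection `f^* P ⟶ P`. -/
noncomputable def pullbackHom : P.pullback f ⟶ P where
  baseMap := f
  totalMap := P.pullbackSnd f
  proj_comm x := (fibreProduct.condition x).symm
  anchor_comm _ := rfl
  act_comm _ _ h := P.pullbackSnd_act f h

end Pullback

/-! ### Sections of the anchor of a principal bundle -/

/-- A lift `s` of the base map of `u` along the anchor of `P` defines a map of bundles, which
sends the point over `x` corresponding to the arrow `g` to `s x · g`. -/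
theorem exists_hom_of_section (u : Q ⟶ unitBundle G) (s : Q.base ⟶ P.total)
    (hs : s ≫ P.anchor = Hom.baseMap u) :
    ∃ φ : Q ⟶ P, Hom.baseMap φ = s ≫ P.proj ∧
      ∀ z, Hom.totalMap φ z = P.act (s (Q.proj z)) (Hom.totalMap u z) := by
  have hanch : ∀ z, P.anchor (s (Q.proj z)) = G.tgt (Hom.totalMap u z) := fun z =>
    (congrArg (fun k : Q.base ⟶ G.Obj => k (Q.proj z)) hs).trans (Hom.proj_comm u z).symm
  refine ⟨{ baseMap := s ≫ P.proj
            totalMap := ⟨fun z => P.act (s (Q.proj z)) (Hom.totalMap u z), ?_⟩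
            proj_comm := fun z => P.proj_act _ _ (hanch z)
            anchor_comm := fun z => (P.anchor_act _ _ (hanch z)).trans (Hom.anchor_comm u z)
            act_comm := fun z g hg => ?_ }, rfl, fun _ => rfl⟩
  · exact contMDiffOn_univ.1 (P.act_smooth.comp
      ((Mfld.contMDiff (Q.proj ≫ s)).prodMk (Mfld.contMDiff (Hom.totalMap u))).contMDiffOn
      fun z _ => hanch z)
  · have h1 : Hom.totalMap u (Q.act z g) = G.mul (Hom.totalMap u z) g := Hom.act_comm u z g hg
    change P.act (s (Q.proj (Q.act z g))) (Hom.totalMap u (Q.act z g)) =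
      P.act (P.act (s (Q.proj z)) (Hom.totalMap u z)) g
    rw [Q.proj_act z g hg, h1]
    exact P.act_mul _ _ g (hanch z) ((Hom.anchor_comm u z).trans hg)

theorem comp_proj_eq_baseMap {u : Q ⟶ unitBundle G} {φ : Q ⟶ P} {s : Q.base ⟶ P.total}
    (hs : s ≫ P.anchor = Hom.baseMap u)
    (hφ : ∀ z, Hom.totalMap φ z = P.act (s (Q.proj z)) (Hom.totalMap u z)) :
    s ≫ P.proj = Hom.baseMap φ := by
  refine ConcreteCategory.hom_ext _ _ fun x => ?_
  obtain ⟨z, rfl⟩ := Q.proj_surjective x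
  have h1 : P.anchor (s (Q.proj z)) = G.tgt (Hom.totalMap u z) :=
    (congrArg (fun k : Q.base ⟶ G.Obj => k (Q.proj z)) hs).trans (Hom.proj_comm u z).symm
  exact (P.proj_act _ _ h1).symm.trans ((congrArg P.proj (hφ z).symm).trans (Hom.proj_comm φ z))

theorem totalMap_comp_eq_act {u : Q ⟶ unitBundle G} {v : R ⟶ unitBundle G} {m : R ⟶ Q}
    (hm : m ≫ u = v) {φ : Q ⟶ P} {s : Q.base ⟶ P.total} {t : R.base ⟶ P.total}
    (hφ : ∀ z, Hom.totalMap φ z = P.act (s (Q.proj z)) (Hom.totalMap u z))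
    (ht : Hom.baseMap m ≫ s = t) (z : R.total) :
    Hom.totalMap (m ≫ φ) z = P.act (t (R.proj z)) (Hom.totalMap v z) := by
  subst hm ht
  refine (hφ (Hom.totalMap m z)).trans ?_
  exact congrArg (fun x => P.act (s x) (Hom.totalMap u (Hom.totalMap m z))) (Hom.proj_comm m z)

/-- Let `u` identify the principal bundle `Q` with the pullback of the unit bundle along a map `r`
from its base. The maps `φ : Q ⟶ P` of principal bundles are then the lifts `s` of `r` along the
anchor of `P`: the value of `s` at `x` is the value of `φ` at the point over `x` which corresponds
to a unit of `G`. -/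
theorem existsUnique_section (u : Q ⟶ unitBundle G) (φ : Q ⟶ P) :
    ∃! s : Q.base ⟶ P.total, s ≫ P.anchor = Hom.baseMap u ∧
      ∀ z, Hom.totalMap φ z = P.act (s (Q.proj z)) (Hom.totalMap u z) := by
  have hex : ∀ x : Q.base, ∃ z, Q.proj z = x ∧ Hom.totalMap u z = G.unit (Hom.baseMap u x) :=
    fun x => Hom.exists_totalMap_eq u (G.tgt_unit _)
  choose e he1 he2 using hex
  have hes : ContMDiff Q.base.model Q.total.model ∞ e := by
    intro x
    obtain ⟨σ, U, hU, hxU, hσ, -, hσq⟩ := exists_localSection Q.proj_submersion (e x)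
    rw [he1] at hxU
    have hs : ContMDiffAt Q.base.model Q.total.model ∞ σ x := hσ.contMDiffAt (hU.mem_nhds hxU)
    have hanch : ∀ y, Q.anchor (σ y) = G.tgt (G.inv (Hom.totalMap u (σ y))) := fun y =>
      (Hom.anchor_comm u (σ y)).symm.trans (G.tgt_inv _).symm
    have hact : ContMDiffAt Q.base.model Q.total.model ∞
        (fun y => Q.act (σ y) (G.inv (Hom.totalMap u (σ y)))) x :=
      Q.act_smooth.comp_contMDiffWithinAt_of_eventually (hs.prodMk
        ((Mfld.contMDiff (Hom.totalMap u ≫ G.inv)).contMDiffAt.comp x hs)) (hanch x)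
        (Filter.Eventually.of_forall hanch)
    refine hact.congr_of_eventuallyEq (Filter.eventually_of_mem (hU.mem_nhds hxU) fun y hy => ?_)
    refine Hom.totalMap_injOn_fibre u ?_ ?_
    · rw [he1, Q.proj_act _ _ (hanch y), hσq y hy]
    · rw [he2, Hom.act_comm u _ _ (hanch y)]
      refine Eq.trans ?_ (G.mul_inv _).symm
      refine congrArg G.unit ?_
      have := Hom.proj_comm u (σ y)
      rw [hσq y hy] at this
      exact this.symm
  have hea : ∀ x, Q.anchor (e x) = Hom.baseMap u x := fun x => by
    rw [← Hom.anchor_comm u, he2]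
    exact G.src_unit _
  refine ⟨⟨fun x => Hom.totalMap φ (e x), (Mfld.contMDiff (Hom.totalMap φ)).comp hes⟩,
    ⟨?_, fun z => ?_⟩, ?_⟩
  · exact ConcreteCategory.hom_ext _ _ fun x => (Hom.anchor_comm φ (e x)).trans (hea x)
  · have h1 : Q.anchor (e (Q.proj z)) = G.tgt (Hom.totalMap u z) :=
      (hea _).trans (Hom.proj_comm u z).symm
    have h2 : Q.act (e (Q.proj z)) (Hom.totalMap u z) = z := by
      refine Hom.totalMap_injOn_fibre u ?_ ?_
      · rw [Q.proj_act _ _ h1, he1]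
      · rw [Hom.act_comm u _ _ h1, he2, ← Hom.proj_comm u]
        exact G.unit_mul _
    change _ = P.act (Hom.totalMap φ (e (Q.proj z))) (Hom.totalMap u z)
    rw [← Hom.act_comm φ _ _ h1, h2]
  · rintro s ⟨hs, hs'⟩
    refine ConcreteCategory.hom_ext _ _ fun x => ?_
    have h1 : P.anchor (s x) = Hom.baseMap u x :=
      congrArg (fun k : Q.base ⟶ G.Obj => k x) hs
    change s x = Hom.totalMap φ (e x)
    rw [hs', he1, he2, ← h1, P.act_unit]

end PrincipalBundle

/-! ### The standard map to the classifying stack -/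

section StandardMap

variable {G : LieGroupoid.{u}}

/-- The smooth map which is an object of `y(X)`. -/
def yoHom {X : Mfld.{u}} (a : (yo X).obj) : (yo X).p.obj a ⟶ X := a.unop.2

theorem yoHom_comp {X : Mfld.{u}} {a b : (yo X).obj} (w : a ⟶ b) :
    yoHom a = (yo X).p.map w ≫ yoHom b := w.unop.2.symm

open PrincipalBundle in
theorem exists_unitPullback_map {a b : (yo G.Obj).obj} (w : a ⟶ b) :
    ∃ c : (unitBundle G).pullback (yoHom a) ⟶ (unitBundle G).pullback (yoHom b),
      Hom.baseMap c = (yo G.Obj).p.map w ∧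
        c ≫ (unitBundle G).pullbackHom (yoHom b) = (unitBundle G).pullbackHom (yoHom a) :=
  Hom.exists_lift _ _ _ (yoHom_comp w)

open PrincipalBundle in
/-- The map `y(Obj) ⟶ BG` that sends `f` to the pullback along `f` of the unit bundle. -/
noncomputable def standardMap (G : LieGroupoid.{u}) :
    BasedFunctor (yo G.Obj) (classifyingStack G) where
  obj a := (unitBundle G).pullback (yoHom a)
  map w := (exists_unitPullback_map w).choose
  map_id a := by
    have h := (exists_unitPullback_map (𝟙 a)).choose_spec
    refine Hom.eq_of_comp_eq ((unitBundle G).pullbackHom (yoHom a)) ?_ ?_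
    · exact h.1.trans ((yo G.Obj).p.map_id a)
    · exact h.2.trans (Category.id_comp _).symm
  map_comp {a b c} v w := by
    have h := (exists_unitPullback_map (v ≫ w)).choose_spec
    have hv := (exists_unitPullback_map v).choose_spec
    have hw := (exists_unitPullback_map w).choose_spec
    refine Hom.eq_of_comp_eq ((unitBundle G).pullbackHom (yoHom c)) ?_ ?_
    · refine h.1.trans (((yo G.Obj).p.map_comp v w).trans ?_)
      exact ((congrArg (fun k => k ≫ Hom.baseMap (exists_unitPullback_map w).choose) hv.1).trans
        (congrArg (fun k => (yo G.Obj).p.map v ≫ k) hw.1)).symm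
    · refine h.2.trans (Eq.symm ((Category.assoc _ _ _).trans ?_))
      exact (congrArg (fun k => (exists_unitPullback_map v).choose ≫ k) hw.2).trans hv.2
  w := Functor.hext (fun _ => rfl) fun _ _ w =>
    heq_of_eq (exists_unitPullback_map w).choose_spec.1

open PrincipalBundle in
theorem isStandardMap_standardMap (G : LieGroupoid.{u}) : IsStandardMap (standardMap G) := by
  let b : (unitBundle G).pullback (𝟙 G.Obj) ⟶ unitBundle G := (unitBundle G).pullbackHom (𝟙 G.Obj)
  have : IsIso (Hom.baseMap b) := inferInstanceAs (IsIso (𝟙 G.Obj))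
  have : IsIso b := Hom.isIso_of_isIso_baseMap b
  let e : (unitBundle G).pullback (𝟙 G.Obj) ≅ unitBundle G := asIso b
  exact ⟨e, IsHomLift.map (classifyingStack G).p b⟩

/-! ### Representing objects of fibre products over a category over manifolds -/

instance isHomLift_yoMap {L N X : Mfld.{u}} {r' : L ⟶ X} {r : N ⟶ X} (w : L ⟶ N)
    (h : w ≫ r = r') : (yo X).p.IsHomLift w (yoMap w h) :=
  IsHomLift.map (yo X).p (yoMap w h)

theorem yoMap_comp {K L N X : Mfld.{u}} {r'' : K ⟶ X} {r' : L ⟶ X} {r : N ⟶ X} (v : K ⟶ L)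
    (w : L ⟶ N) (hv : v ≫ r' = r'') (hw : w ≫ r = r') :
    yoMap v hv ≫ yoMap w hw = yoMap (v ≫ w) (by rw [Category.assoc, hw, hv]) := rfl

namespace RepresentsFibreProduct

variable {𝒳 : BasedCategory.{u, u + 1} Mfld.{u}} {X : Mfld.{u}} {θ : BasedFunctor (yo X) 𝒳}
  {P P' : 𝒳.obj} {M N N' : Mfld.{u}} {q : N ⟶ M} {r : N ⟶ X} {φ : θ.obj (yoObj r) ⟶ P}

theorem comp_iso (h : RepresentsFibreProduct θ q r φ) (e : P ≅ P')
    (he : 𝒳.p.IsHomLift (𝟙 M) e.hom) : RepresentsFibreProduct θ q r (φ ≫ e.hom) where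
  isHomLift := by
    have := h.isHomLift
    exact IsHomLift.comp_lift_id_right 𝒳.p q φ e.hom
  existsUnique L k r' φ' hφ' := by
    have : 𝒳.p.IsHomLift (𝟙 M) e.inv := IsHomLift.lift_id_inv 𝒳.p M e
    obtain ⟨w, ⟨hw, hr, hφ⟩, huniq⟩ := h.existsUnique L k r' (φ' ≫ e.inv)
      (IsHomLift.comp_lift_id_right 𝒳.p k φ' e.inv)
    refine ⟨w, ⟨hw, hr, ?_⟩, ?_⟩
    · rw [← Category.assoc, hφ, Category.assoc, e.inv_hom_id, Category.comp_id]
    · rintro w' ⟨hw', hr', hφ'⟩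
      refine huniq w' ⟨hw', hr', ?_⟩
      rw [← hφ', ← Category.assoc, Category.assoc _ e.hom, e.hom_inv_id, Category.comp_id]

theorem iso_comp (h : RepresentsFibreProduct θ q r φ) (i : N' ≅ N) {r' : N' ⟶ X}
    (hr : i.hom ≫ r = r') :
    RepresentsFibreProduct θ (i.hom ≫ q) r' (θ.map (yoMap i.hom hr) ≫ φ) where
  isHomLift := by
    have := h.isHomLift
    exact IsHomLift.comp 𝒳.p i.hom q _ φ
  existsUnique L k s φ' hφ' := by
    subst hr
    obtain ⟨w, ⟨hw, hws, hφ⟩, huniq⟩ := h.existsUnique L k s φ' hφ'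
    refine ⟨w ≫ i.inv, ⟨?_, ?_, ?_⟩, ?_⟩
    · rw [Category.assoc, i.inv_hom_id_assoc, hw]
    · rw [Category.assoc, i.inv_hom_id_assoc, hws]
    · rw [← Category.assoc, ← Functor.map_comp, yoMap_comp, ← hφ]
      congr 3
      rw [Category.assoc, i.inv_hom_id, Category.comp_id]
    · rintro w' ⟨hw', hs', hφw⟩
      have hwi : w' ≫ i.hom = w := by
        refine huniq (w' ≫ i.hom) ⟨(Category.assoc _ _ _).trans hw',
          (Category.assoc _ _ _).trans hs', ?_⟩
        exact ((congrArg (fun k => k ≫ φ) (θ.map_comp (yoMap w' hs') (yoMap i.hom rfl))).trans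
          (Category.assoc _ _ _)).trans hφw
      rw [← hwi, Category.assoc, i.hom_inv_id, Category.comp_id]

end RepresentsFibreProduct

/-! ### The standard map is an atlas -/

section HomLift

open PrincipalBundle

theorem baseMap_comp_eqToHom_of_isHomLift {P Q : PrincipalBundle G} {M N : Mfld.{u}}
    {f : M ⟶ N} {φ : P ⟶ Q} (hP : P.base = M) (hQ : Q.base = N)
    (h : (classifyingStack G).p.IsHomLift f (a := P) (b := Q) φ) :
    Hom.baseMap φ ≫ eqToHom hQ = eqToHom hP ≫ f := by
  subst hP hQ
  refine (Category.comp_id _).trans (Eq.trans ?_ (Category.id_comp _).symm)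
  exact (@IsHomLift.eq_of_isHomLift _ _ _ _ (classifyingStack G).p P Q f φ h).symm

theorem baseMap_eq_of_isHomLift {P Q : PrincipalBundle G} {M : Mfld.{u}} {f : M ⟶ Q.base}
    {φ : P ⟶ Q} (hP : P.base = M)
    (h : (classifyingStack G).p.IsHomLift f (a := P) (b := Q) φ) :
    Hom.baseMap φ = eqToHom hP ≫ f :=
  (Category.comp_id _).symm.trans (baseMap_comp_eqToHom_of_isHomLift hP rfl h)

theorem isHomLift_of_baseMap_eq {P Q : PrincipalBundle G} {M : Mfld.{u}} {f : M ⟶ Q.base}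
    {φ : P ⟶ Q} (hP : P.base = M) (h : Hom.baseMap φ = eqToHom hP ≫ f) :
    (classifyingStack G).p.IsHomLift f (a := P) (b := Q) φ := by
  subst hP
  have h' : Hom.baseMap φ = f := h.trans (Category.id_comp _)
  subst h'
  exact IsHomLift.map (classifyingStack G).p (a := P) (b := Q) φ

theorem isHomLift_map_yoMap {𝒳 : BasedCategory.{u, u + 1} Mfld.{u}} {X : Mfld.{u}}
    (θ : BasedFunctor (yo X) 𝒳) {L N : Mfld.{u}} {r' : L ⟶ X} {r : N ⟶ X} (w : L ⟶ N)
    (h : w ≫ r = r') : 𝒳.p.IsHomLift w (θ.map (yoMap w h)) :=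
  inferInstance

end HomLift

/-- Inversion, as a diffeomorphism of the manifold of arrows of a Lie groupoid. -/
noncomputable def LieGroupoid.invIso (G : LieGroupoid.{u}) : G.Arr ≅ G.Arr :=
  have h : G.inv ≫ G.inv = 𝟙 G.Arr := ConcreteCategory.hom_ext _ _ fun g => by
    change G.inv (G.inv g) = g
    have h1 : G.src (G.inv (G.inv g)) = G.tgt (G.inv g) := G.src_inv _
    have h2 : G.src (G.inv g) = G.tgt g := G.src_inv _
    rw [← G.mul_unit (G.inv (G.inv g)), h1, G.tgt_inv, ← G.inv_mul g,
      ← G.mul_assoc _ _ _ h1 h2, G.inv_mul, h2, G.unit_mul]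
  ⟨G.inv, G.inv, h, h⟩

namespace IsStandardMap

variable {θ : BasedFunctor (yo G.Obj) (classifyingStack G)}

open PrincipalBundle

/-- The standard map sends every object `r` to the pullback of the unit bundle along `r`, by
compatible identifications. -/
theorem exists_unitHom (hθ : IsStandardMap θ) :
    ∃ u : ∀ {N : Mfld.{u}} (r : N ⟶ G.Obj), θ.obj (yoObj r) ⟶
        (unitBundle G : (classifyingStack G).obj),
      (∀ {N : Mfld.{u}} (r : N ⟶ G.Obj), (classifyingStack G).p.IsHomLift r (u r)) ∧
      ∀ {L N : Mfld.{u}} {r' : L ⟶ G.Obj} {r : N ⟶ G.Obj} (w : L ⟶ N) (h : w ≫ r = r'),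
        θ.map (yoMap w h) ≫ u r = u r' := by
  obtain ⟨e, he⟩ := hθ
  refine ⟨fun r => θ.map (yoMap r (Category.comp_id r)) ≫ e.hom, fun r => ?_, fun w h => ?_⟩
  · exact IsHomLift.comp_lift_id_right (classifyingStack G).p r _ e.hom
  · subst h
    refine (Category.assoc _ _ _).symm.trans ?_
    exact congrArg (fun k => k ≫ e.hom)
      (θ.map_comp (yoMap w rfl) (yoMap _ (Category.comp_id _))).symm

/-- For every principal bundle `P`, its total space, with the bundle projection and the anchor,
represents the fibre product over `BG` along the standard map. -/
theorem exists_representsFibreProduct (hθ : IsStandardMap θ) (P : PrincipalBundle G) :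
    ∃ φ : θ.obj (yoObj P.anchor) ⟶ (P : (classifyingStack G).obj),
      RepresentsFibreProduct θ P.proj P.anchor φ := by
  obtain ⟨u, hu, hcomp⟩ := hθ.exists_unitHom
  have hub : ∀ {N : Mfld.{u}} (r : N ⟶ G.Obj),
      Hom.baseMap (u r) = eqToHom (θ.w_obj (yoObj r)) ≫ r :=
    fun r => baseMap_eq_of_isHomLift (θ.w_obj (yoObj r)) (hu r)
  obtain ⟨φ, hφb, hφ⟩ := exists_hom_of_section (P := P) (u P.anchor)
    (eqToHom (θ.w_obj (yoObj P.anchor))) (hub P.anchor).symm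
  refine ⟨φ, isHomLift_of_baseMap_eq (θ.w_obj (yoObj P.anchor)) hφb, fun L h r' φ' hφ' => ?_⟩
  let e : (θ.obj (yoObj r')).base ⟶ L := eqToHom (θ.w_obj (yoObj r'))
  let e' : L ⟶ (θ.obj (yoObj r')).base := eqToHom (θ.w_obj (yoObj r')).symm
  have hee' : e ≫ e' = 𝟙 _ := eqToHom_trans _ _
  have he'e : e' ≫ e = 𝟙 _ := eqToHom_trans _ _
  obtain ⟨s, ⟨hs, hsφ⟩, huniq⟩ := existsUnique_section (P := P) (u r') φ'
  have hφ'b : Hom.baseMap φ' = e ≫ h := baseMap_eq_of_isHomLift _ hφ'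
  -- The composite of `φ` with the arrow induced by `w` corresponds to the section `w`.
  have key : ∀ (w : L ⟶ P.total) (hw : w ≫ P.anchor = r') (z : (θ.obj (yoObj r')).total),
      Hom.totalMap (θ.map (yoMap w hw) ≫ φ) z =
        P.act ((e ≫ w) ((θ.obj (yoObj r')).proj z)) (Hom.totalMap (u r') z) := fun w hw =>
    totalMap_comp_eq_act (hcomp w hw) hφ
      (baseMap_comp_eqToHom_of_isHomLift _ _ (isHomLift_map_yoMap θ w hw))
  have hr' : Hom.baseMap (u r') = e ≫ r' := hub r'
  refine ⟨e' ≫ s, ⟨?_, ?_, ?_⟩, ?_⟩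
  · have h1 : s ≫ P.proj = e ≫ h := by
      rw [← hφ'b]
      exact comp_proj_eq_baseMap hs hsφ
    rw [Category.assoc, h1, ← Category.assoc, he'e, Category.id_comp]
  · rw [Category.assoc, hs, hr', ← Category.assoc, he'e, Category.id_comp]
  · refine Hom.ext_totalMap fun z => ?_
    refine (key _ _ z).trans (Eq.trans ?_ (hsφ z).symm)
    rw [← Category.assoc, hee', Category.id_comp]
  · rintro w ⟨-, hw, hwφ⟩
    have hws : e ≫ w = s := huniq _ ⟨by rw [Category.assoc, hw, hr'], fun z => by
      rw [← hwφ]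
      exact key w hw z⟩
    rw [← hws, ← Category.assoc, he'e, Category.id_comp]

theorem isStackAtlas (hθ : IsStandardMap θ) : IsStackAtlas θ := fun P => by
  obtain ⟨φ, hφ⟩ := hθ.exists_representsFibreProduct P
  exact ⟨P.total, P.proj, P.anchor, φ, hφ, P.proj_surjective, P.proj_submersion⟩

/-- The unit bundle, with the projections `tgt` and `src`, represents the fibre product of the
standard map with itself, and inversion interchanges the two projections. -/
theorem presents (hθ : IsStandardMap θ) : Presents θ := by
  obtain ⟨φ, hφ⟩ := hθ.exists_representsFibreProduct (unitBundle G)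
  obtain ⟨e, he⟩ := hθ
  have he' : (classifyingStack G).p.IsHomLift (𝟙 G.Obj) e.symm.hom :=
    IsHomLift.lift_id_inv (classifyingStack G).p G.Obj e
  have hsrc : G.inv ≫ G.src = G.tgt := ConcreteCategory.hom_ext _ _ G.src_inv
  have htgt : G.inv ≫ G.tgt = G.src := ConcreteCategory.hom_ext _ _ G.tgt_inv
  have h : RepresentsFibreProduct θ (G.inv ≫ G.tgt) G.tgt _ :=
    (hφ.comp_iso e.symm he').iso_comp G.invIso hsrc
  rw [htgt] at h
  exact ⟨_, h⟩

end IsStandardMap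

end StandardMap

/-! ### Forms on a category over manifolds -/

section StackForm

variable {𝒳 : BasedCategory.{u, u + 1} Mfld.{u}} {k : ℕ}

/-- The differential form which is part of an object of `∫ Ω^k`. -/
def elementForm (x : (elementsOver (formSheaf.{u} k)).obj) :
    DiffForm ((elementsOver (formSheaf.{u} k)).p.obj x) k := x.unop.2

theorem pullback_elementForm {x y : (elementsOver (formSheaf.{u} k)).obj} (f : x ⟶ y) :
    DiffForm.pullback ((elementsOver (formSheaf.{u} k)).p.map f) (elementForm y) =
      elementForm x := f.unop.2

theorem elementForm_ext {x y : (elementsOver (formSheaf.{u} k)).obj}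
    (h : (elementsOver (formSheaf.{u} k)).p.obj x = (elementsOver (formSheaf.{u} k)).p.obj y)
    (h' : DiffForm.pullback (eqToHom h) (elementForm y) = elementForm x) : x = y := by
  obtain ⟨⟨M⟩, a⟩ := x
  obtain ⟨⟨N⟩, b⟩ := y
  change M = N at h
  subst h
  obtain rfl : b = a := (DiffForm.pullback_id _).symm.trans h'
  rfl

instance : (elementsOver (formSheaf.{u} k)).p.Faithful :=
  inferInstanceAs (CategoryOfElements.π (formSheaf.{u} k)).leftOp.Faithful

namespace StackForm

/-- The value of a form `α` on `𝒳` at an object `P`, as a differential form on the base of `P`.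
The pullback along `eqToHom` only identifies two equal manifolds. -/
noncomputable def value (α : StackForm 𝒳 k) (P : 𝒳.obj) : DiffForm (𝒳.p.obj P) k :=
  DiffForm.pullback (eqToHom (α.w_obj P).symm) (elementForm (α.obj P))

theorem map_eq (α : StackForm 𝒳 k) {P Q : 𝒳.obj} (φ : P ⟶ Q) :
    (elementsOver (formSheaf k)).p.map (α.map φ) =
      eqToHom (α.w_obj P) ≫ 𝒳.p.map φ ≫ eqToHom (α.w_obj Q).symm :=
  Functor.congr_hom α.w φ

theorem value_eq_pullback (α : StackForm 𝒳 k) {P Q : 𝒳.obj} (φ : P ⟶ Q) :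
    α.value P = DiffForm.pullback (𝒳.p.map φ) (α.value Q) := by
  unfold value
  rw [← pullback_elementForm (α.map φ), α.map_eq, ← DiffForm.pullback_comp,
    ← DiffForm.pullback_comp, eqToHom_trans_assoc, eqToHom_refl, Category.id_comp]

/-- The value of `α` at `P`, as a form on a manifold which is equal to the base of `P`. -/
noncomputable def valueOn (α : StackForm 𝒳 k) (P : 𝒳.obj) {M : Mfld.{u}} (h : 𝒳.p.obj P = M) :
    DiffForm M k :=
  DiffForm.pullback (eqToHom h.symm) (α.value P)

theorem valueOn_eq_pullback (α : StackForm 𝒳 k) {P Q : 𝒳.obj} {M N : Mfld.{u}} {f : M ⟶ N}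
    {φ : P ⟶ Q} (h : 𝒳.p.IsHomLift f φ) (hP : 𝒳.p.obj P = M) (hQ : 𝒳.p.obj Q = N) :
    α.valueOn P hP = DiffForm.pullback f (α.valueOn Q hQ) := by
  obtain ⟨⟩ := h
  unfold valueOn
  rw [eqToHom_refl, eqToHom_refl, DiffForm.pullback_id, DiffForm.pullback_id]
  exact α.value_eq_pullback φ

theorem valueOn_rfl (α : StackForm 𝒳 k) (P : 𝒳.obj) : α.valueOn P rfl = α.value P :=
  DiffForm.pullback_id _

/-- A form on `𝒳` is determined by its values. -/
theorem ext_value {α β : StackForm 𝒳 k} (h : ∀ P, α.value P = β.value P) : α = β := by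
  have hobj : ∀ P, α.obj P = β.obj P := fun P => by
    refine elementForm_ext ((α.w_obj P).trans (β.w_obj P).symm) ?_
    have h1 := congrArg (DiffForm.pullback (eqToHom (α.w_obj P))) (h P)
    unfold value at h1
    rw [← DiffForm.pullback_comp, ← DiffForm.pullback_comp, eqToHom_trans, eqToHom_trans,
      eqToHom_refl, DiffForm.pullback_id] at h1
    exact h1.symm
  have hfun : α.toFunctor = β.toFunctor := by
    refine CategoryTheory.Functor.ext hobj fun P Q φ => ?_
    apply (elementsOver (formSheaf k)).p.map_injective
    rw [Functor.map_comp, Functor.map_comp, eqToHom_map, eqToHom_map, α.map_eq, β.map_eq]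
    simp
  cases α
  cases β
  congr

/-- A family of forms on the bases of the objects of `𝒳` which is compatible with pullbacks is the
family of values of a form on `𝒳`. -/
theorem exists_value_eq (η : ∀ P : 𝒳.obj, DiffForm (𝒳.p.obj P) k)
    (h : ∀ {P Q : 𝒳.obj} (φ : P ⟶ Q), DiffForm.pullback (𝒳.p.map φ) (η Q) = η P) :
    ∃ α : StackForm 𝒳 k, ∀ P, α.value P = η P := by
  let α : StackForm 𝒳 k :=
    { obj := fun P => op ((formSheaf k).elementsMk (op (𝒳.p.obj P)) (η P))
      map := fun {P Q} φ => Quiver.Hom.op (CategoryOfElements.homMk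
        ((formSheaf k).elementsMk (op (𝒳.p.obj Q)) (η Q))
        ((formSheaf k).elementsMk (op (𝒳.p.obj P)) (η P)) (𝒳.p.map φ).op (h φ))
      map_id := fun P => by
        apply Quiver.Hom.unop_inj
        apply CategoryOfElements.ext
        exact congrArg Quiver.Hom.op (𝒳.p.map_id P)
      map_comp := fun φ ψ => by
        apply Quiver.Hom.unop_inj
        apply CategoryOfElements.ext
        exact congrArg Quiver.Hom.op (𝒳.p.map_comp φ ψ)
      w := rfl }
  exact ⟨α, fun P => DiffForm.pullback_id _⟩

end StackForm

/-! ### Forms on a category with an atlas -/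

section Atlas

variable {X : Mfld.{u}} (θ : BasedFunctor (yo X) 𝒳)

theorem yonedaForm_comp (α : StackForm 𝒳 k) :
    yonedaForm (θ.comp α) = α.valueOn (θ.obj (yoObj (𝟙 X))) (θ.w_obj (yoObj (𝟙 X))) := by
  have h : yonedaForm (θ.comp α) = DiffForm.pullback
      (eqToHom ((α.w_obj (θ.obj (yoObj (𝟙 X)))).trans (θ.w_obj (yoObj (𝟙 X)))).symm)
      (elementForm (α.obj (θ.obj (yoObj (𝟙 X))))) := rfl
  rw [h, StackForm.valueOn, StackForm.value, ← DiffForm.pullback_comp, eqToHom_trans]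

theorem valueOn_obj_yoObj (α : StackForm 𝒳 k) {N : Mfld.{u}} (r : N ⟶ X) :
    α.valueOn (θ.obj (yoObj r)) (θ.w_obj (yoObj r)) =
      DiffForm.pullback r (yonedaForm (θ.comp α)) := by
  rw [yonedaForm_comp]
  exact α.valueOn_eq_pullback (isHomLift_map_yoMap θ r (Category.comp_id r)) _ _

variable {θ}

theorem pullback_value_eq (α : StackForm 𝒳 k) {P : 𝒳.obj} {N : Mfld.{u}} {q : N ⟶ 𝒳.p.obj P}
    {r : N ⟶ X} {φ : θ.obj (yoObj r) ⟶ P} (h : 𝒳.p.IsHomLift q φ) :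
    DiffForm.pullback q (α.value P) = DiffForm.pullback r (yonedaForm (θ.comp α)) := by
  refine Eq.trans ?_ (valueOn_obj_yoObj θ α r)
  refine Eq.trans ?_ (α.valueOn_eq_pullback h _ rfl).symm
  rw [α.valueOn_rfl]

/-- A form on `𝒳` is determined by its pullback to an atlas. -/
theorem IsStackAtlas.injective_yonedaForm_comp (hθ : IsStackAtlas θ) :
    Function.Injective (fun α : StackForm 𝒳 k => yonedaForm (θ.comp α)) := by
  intro α β h
  refine StackForm.ext_value fun P => ?_
  obtain ⟨N, q, r, φ, hφ, hs, hq⟩ := hθ P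
  refine DiffForm.pullback_injective hq hs ?_
  rw [pullback_value_eq α hφ.isHomLift, pullback_value_eq β hφ.isHomLift]
  exact congrArg (DiffForm.pullback r) h

theorem isHomLift_eqToHom_id {P : 𝒳.obj} {M : Mfld.{u}} (h : 𝒳.p.obj P = M) :
    𝒳.p.IsHomLift (eqToHom h.symm) (𝟙 P) := by
  subst h
  rw [eqToHom_refl]
  infer_instance

/-- A form `μ` on an atlas comes from a form on `𝒳` if its pullbacks along any two maps which become
isomorphic in `𝒳` agree. -/
theorem IsStackAtlas.exists_yonedaForm_comp_eq (hθ : IsStackAtlas θ) (μ : DiffForm X k)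
    (hμ : ∀ (P : 𝒳.obj) {K : Mfld.{u}} (h : K ⟶ 𝒳.p.obj P) (r₁ r₂ : K ⟶ X)
      (φ₁ : θ.obj (yoObj r₁) ⟶ P) (φ₂ : θ.obj (yoObj r₂) ⟶ P), 𝒳.p.IsHomLift h φ₁ →
      𝒳.p.IsHomLift h φ₂ → DiffForm.pullback r₁ μ = DiffForm.pullback r₂ μ) :
    ∃ α : StackForm 𝒳 k, yonedaForm (θ.comp α) = μ := by
  have hex : ∀ P : 𝒳.obj, ∃ η : DiffForm (𝒳.p.obj P) k, ∀ {L : Mfld.{u}} (h : L ⟶ 𝒳.p.obj P)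
      (r : L ⟶ X) (φ : θ.obj (yoObj r) ⟶ P), 𝒳.p.IsHomLift h φ →
      DiffForm.pullback h η = DiffForm.pullback r μ := by
    intro P
    obtain ⟨N, q, r, φ, hφ, hs, hq⟩ := hθ P
    have := hφ.isHomLift
    have hcond : fibreProduct.fst q q hq ≫ q = fibreProduct.snd q q hq ≫ q :=
      ConcreteCategory.hom_ext _ _ fun x => fibreProduct.condition x
    obtain ⟨η, hη⟩ := DiffForm.exists_pullback_eq (ν := DiffForm.pullback r μ) (hq := hq) hs (by
      rw [← DiffForm.pullback_comp, ← DiffForm.pullback_comp]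
      refine hμ P (fibreProduct.fst q q hq ≫ q) _ _
        (θ.map (yoMap (fibreProduct.fst q q hq) rfl) ≫ φ)
        (θ.map (yoMap (fibreProduct.snd q q hq) rfl) ≫ φ)
        (IsHomLift.comp 𝒳.p _ _ _ _) ?_
      rw [hcond]
      exact IsHomLift.comp 𝒳.p _ _ _ _)
    refine ⟨η, fun {L} h r' φ' hφ' => ?_⟩
    obtain ⟨w, ⟨rfl, rfl, -⟩, -⟩ := hφ.existsUnique L h r' φ' hφ'
    rw [DiffForm.pullback_comp, DiffForm.pullback_comp, hη]
  choose η hη using hex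
  obtain ⟨α, hα⟩ := StackForm.exists_value_eq η fun {P Q} a => by
    obtain ⟨N, q, r, φ, hφ, hs, hq⟩ := hθ P
    have := hφ.isHomLift
    refine DiffForm.pullback_injective hq hs ?_
    rw [hη P q r φ hφ.isHomLift, ← DiffForm.pullback_comp]
    exact hη Q _ r (φ ≫ a) (IsHomLift.comp 𝒳.p q (𝒳.p.map a) φ a)
  refine ⟨α, ?_⟩
  rw [yonedaForm_comp, StackForm.valueOn, hα]
  refine (hη _ _ (𝟙 X) (𝟙 _) ?_).trans (DiffForm.pullback_id μ)
  exact isHomLift_eqToHom_id (θ.w_obj (yoObj (𝟙 X)))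

end Atlas

end StackForm

/-! ### Basic forms -/

section Basic

variable {G : LieGroupoid.{u}} {k : ℕ} {θ : BasedFunctor (yo G.Obj) (classifyingStack G)}

theorem Presents.yonedaForm_mem_basicForms (hp : Presents θ)
    (α : StackForm (classifyingStack G) k) : yonedaForm (θ.comp α) ∈ basicForms G k := by
  obtain ⟨φ, hφ⟩ := hp
  change DiffForm.pullback _ _ = DiffForm.pullback _ _
  rw [← valueOn_obj_yoObj θ α G.tgt, yonedaForm_comp]
  exact (α.valueOn_eq_pullback hφ.isHomLift _ _).symm

/-- Two maps `r₁` and `r₂` to the manifold of objects which classify isomorphic bundles are the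
source and the target of a smooth family of arrows. -/
theorem Presents.exists_arrow (hp : Presents θ) {P : PrincipalBundle G} {K : Mfld.{u}}
    {h : K ⟶ P.base} {r₁ r₂ : K ⟶ G.Obj} {φ₁ : θ.obj (yoObj r₁) ⟶ (P : (classifyingStack G).obj)}
    {φ₂ : θ.obj (yoObj r₂) ⟶ (P : (classifyingStack G).obj)}
    (h₁ : (classifyingStack G).p.IsHomLift h φ₁) (h₂ : (classifyingStack G).p.IsHomLift h φ₂) :
    ∃ w : K ⟶ G.Arr, w ≫ G.src = r₁ ∧ w ≫ G.tgt = r₂ := by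
  have e₁ := baseMap_eq_of_isHomLift (θ.w_obj (yoObj r₁)) h₁
  have e₂ := baseMap_eq_of_isHomLift (θ.w_obj (yoObj r₂)) h₂
  obtain ⟨c, hc, -⟩ := PrincipalBundle.Hom.exists_lift φ₁ φ₂
    (eqToHom ((θ.w_obj (yoObj r₂)).trans (θ.w_obj (yoObj r₁)).symm)) (by
      rw [e₁, e₂]
      exact (eqToHom_trans_assoc _ _ _).symm)
  let c' : θ.obj (yoObj r₂) ⟶ θ.obj (yoObj r₁) := c
  have hc' : (classifyingStack G).p.IsHomLift (𝟙 K) c' := by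
    refine IsHomLift.of_fac' _ _ _ (θ.w_obj (yoObj r₂)) (θ.w_obj (yoObj r₁)) (hc.trans ?_)
    rw [Category.id_comp]
    exact (eqToHom_trans _ _).symm
  obtain ⟨φ, hφ⟩ := hp
  obtain ⟨w, ⟨hs, ht, -⟩, -⟩ := hφ.existsUnique K r₁ r₂
    (c' ≫ θ.map (yoMap r₁ (Category.comp_id r₁)))
    (IsHomLift.comp_lift_id_left (classifyingStack G).p r₁ _ c')
  exact ⟨w, hs, ht⟩

theorem IsStackAtlas.bijOn_basicForms (hθ : IsStackAtlas θ) (hp : Presents θ) :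
    Set.BijOn (fun α : StackForm (classifyingStack G) k => yonedaForm (θ.comp α))
      Set.univ (basicForms G k) := by
  refine ⟨fun α _ => hp.yonedaForm_mem_basicForms α, hθ.injective_yonedaForm_comp.injOn,
    fun μ hμ => ?_⟩
  obtain ⟨α, hα⟩ := hθ.exists_yonedaForm_comp_eq μ fun P K h r₁ r₂ φ₁ φ₂ h₁ h₂ => by
    obtain ⟨w, rfl, rfl⟩ := hp.exists_arrow h₁ h₂
    rw [DiffForm.pullback_comp, DiffForm.pullback_comp]
    exact congrArg (DiffForm.pullback w) hμ
  exact ⟨α, trivial, hα⟩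

end Basic

theorem proposition5 (G : LieGroupoid.{u}) (k : ℕ) :
    (∃ θ : BasedFunctor (yo G.Obj) (classifyingStack G), IsStandardMap θ) ∧
    (∀ θ : BasedFunctor (yo G.Obj) (classifyingStack G),
      IsStandardMap θ → IsStackAtlas θ ∧ Presents θ) ∧
    ∀ θ : BasedFunctor (yo G.Obj) (classifyingStack G), IsStackAtlas θ → Presents θ →
      Set.BijOn (fun α : StackForm (classifyingStack G) k => yonedaForm (θ.comp α))
        Set.univ (basicForms G k) :=
  ⟨⟨standardMap G, isStandardMap_standardMap G⟩, fun _ hθ => ⟨hθ.isStackAtlas, hθ.presents⟩,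
    fun _ hθ hp => hθ.bijOn_basicForms hp⟩
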